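/- Let $\mathcal H,\mathcal G$ be real Hilbert spaces, $M:\mathcal H\to\mathcal G$ a bounded linear operator, $f:\mathcal H\to\mathbb R$ convex and differentiable with $L_f$-Lipschitz gradient, i.e. $f(x)\le f(y)+\langle x-y,\nabla f(y)\rangle+\frac{L_f}{2}\|x-y\|^2$ for all $x,y$ (with $L_f\ge 0$, and $L_f>0$ or $M\ne0$), and let $g:\mathcal H\to(-\infty,+\infty]$ and $h:\mathcal G\to(-\infty,+\infty]$ be proper, lower semicontinuous and convex with $M(\operatorname{dom} g)\cap\operatorname{dom}h\neq\emptyset$. Let $F^\star=\inf_x\{f(x)+g(x)+h(Mx)\}$ and let $\mathcal P^\star$ be the set of minimizers, assumed non-empty. Let $h^*$ be the conjugate of $h$, let $\mathcal L(x,y)=f(x)+g(x)+\langle Mx,y\rangle-h^*(y)$ be the Lagrangian and let $\mathcal D^\star$ be the set of maximizers of $y\mapsto\inf_x\mathcal L(x,y)$. Let $S$ be a bounded self-adjoint operator on $\mathcal G$ with $\langle y,Sy\rangle\ge\sigma\|y\|^2$ for some $\sigma>0$ and all $y$; put $\|y\|_S=\sqrt{\langle y,Sy\rangle}$, $\|y\|_{S^{-1}}=\sqrt{\langle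 y,S^{-1}y\rangle}$ and $\|M\|_{S^{-1}}=\sup_{x\ne0}\|Mx\|_{S^{-1}}/\|x\|$. Fix $\dot y\in\mathcal G$ and, for $\beta>0$, let $y^*_\beta(u;\dot y)=\operatorname{argmax}_{y}\{\langle u,y\rangle-h^*(y)-\frac\beta2\|y-\dot y\|_S^2\}$. Given $\tau_0=1$, $\beta_0>0$ and $\bar x^0,\tilde x^0\in\mathcal H$, let the algorithm generate, for $k=0,1,\dots$: $\hat x^k=(1-\tau_k)\bar x^k+\tau_k\tilde x^k$; $\beta_{k+1}=\beta_k/(1+\tau_k)$ and $B_{k+1}=L_f+\|M\|_{S^{-1}}^2/\beta_{k+1}$; $v^k=M^*y^*_{\beta_{k+1}}(M\hat x^k;\dot y)$; $\tilde x^{k+1}=\operatorname{prox}_{\frac1{\tau_kB_{k+1}}g}\big(\tilde x^k-\frac1{\tau_kB_{k+1}}(\nabla f(\hat x^k)+v^k)\big)$; $\bar x^{k+1}=\hat x^k+\tau_k(\tilde x^{k+1}-\tilde x^k)$; and $\tau_{k+1}$ the unique positive root of $\frac{B_{k+1}-L_f}{B_{k+1}}\tau^3+\tau^2+\tau_k^2\tau-\tau_k^2=0$.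 In particular $\beta_1=\beta_0/2$. For a convex set $C$, let $\operatorname{ri}C$ be the set of $x\in C$ such that the cone generated by $C-x$ equals the linear span of $C-x$. (i) Suppose that $h=\iota_{\{c\}}$ for some $c\in\mathcal G$ and that $\operatorname{ri}(\operatorname{dom}g)\cap\{x: Mx=c\}\ne\emptyset$. Write $F=f+g$. Let $(x^\star,y^\star)\in\mathcal P^\star\times\mathcal D^\star$ and suppose that either the subspace $M(\operatorname{span}(\operatorname{dom}g-\operatorname{dom}g))$ is closed in $\mathcal G$ (which is automatic in finite dimension) or $(x^\star,y^\star)$ is a saddle point of $\mathcal L$. Then for all $k\in\mathbb N$: $$F(\bar x^{k+1})-F(x^\star)\ge-\|y^\star\|_S\,\|M\bar x^{k+1}-c\|_{S^{-1}},$$ $$F(\bar x^{k+1})-F(x^\star)\le\frac1{k+1}\Big(\frac{L_f}2+\frac{\|M\|_{S^{-1}}^2}{2\beta_1}\Big)\|\tilde x^0-x^\star\|^2+\|y^\star\|_S\,\|M\bar x^{k+1}-c\|_{S^{-1}}+\frac{\beta_0}{2(k+1)}\|y^\star-\dot y\|_S^2,$$ $$\|M\bar x^{k+1}-c\|_{S^{-1}}\le\frac{\beta_0}{k+1}\bigg[\|y^\star-\dot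 y\|_S+\bigg(\|y^\star-\dot y\|_S^2+\frac2{\beta_0}\Big(\frac{L_f}2+\frac{\|M\|_{S^{-1}}^2}{2\beta_1}\Big)\|\tilde x^0-x^\star\|^2\bigg)^{1/2}\bigg].$$ (ii) Suppose that $h$ is $D_{\mathcal Y}$-Lipschitz continuous with respect to the norm dual to $\|\cdot\|_S$, i.e. $|h(u)-h(v)|\le D_{\mathcal Y}\|u-v\|_{S^{-1}}$ for all $u,v$. Write $F(x)=f(x)+g(x)+h(Mx)$. Then for all $x^\star\in\mathcal P^\star$ and all $k\in\mathbb N$: $$F(\bar x^{k+1})-F^\star\le\frac1{k+1}\Big(\frac{L_f}2+\frac{\|M\|_{S^{-1}}^2}{2\beta_1}\Big)\|\tilde x^0-x^\star\|^2+\frac{\beta_0}{k+1}\big[D_{\mathcal Y}^2+\|\dot y\|_S^2\big].$$ -/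

import Mathlib

open scoped Gradient InnerProductSpace

noncomputable section

namespace SmoothASGARD

variable {H G : Type*}
  [NormedAddCommGroup H] [InnerProductSpace ℝ H] [CompleteSpace H]
  [NormedAddCommGroup G] [InnerProductSpace ℝ G] [CompleteSpace G]

/-- `φ` is a proper, lower semicontinuous, convex function with values in `(-∞, +∞]`
(convexity is convexity of the epigraph). -/
structure IsProperLscConvex {E : Type*} [NormedAddCommGroup E] [InnerProductSpace ℝ E]
    (φ : E → EReal) : Prop where
  ne_bot : ∀ x, φ x ≠ ⊥
  exists_lt_top : ∃ x, φ x < ⊤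
  lsc : LowerSemicontinuous φ
  convex : Convex ℝ {p : E × ℝ | φ p.1 ≤ (p.2 : EReal)}

/-- The effective domain of an extended-real-valued function. -/
def dom {E : Type*} (φ : E → EReal) : Set E := {x | φ x < ⊤}

/-- The real function `f` is convex and differentiable, and its gradient is `L`-Lipschitz, expressed
by the quadratic upper bound. -/
structure IsConvexWithLipschitzGradient (f : H → ℝ) (L : ℝ) : Prop where
  convex : ConvexOn ℝ Set.univ f
  differentiable : Differentiable ℝ f
  le_quadratic : ∀ x y, f x ≤ f y + ⟪x - y, ∇ f y⟫_ℝ + L / 2 * ‖x - y‖ ^ 2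

/-- `S` is a (bounded, self-adjoint) positive definite operator: `⟪y, S y⟫ ≥ σ ‖y‖ ^ 2` for some
`σ > 0`. -/
structure IsPositiveDefinite (S : G →L[ℝ] G) : Prop where
  selfAdjoint : IsSelfAdjoint S
  coercive : ∃ σ : ℝ, 0 < σ ∧ ∀ y, σ * ‖y‖ ^ 2 ≤ ⟪y, S y⟫_ℝ

/-- The norm `‖y‖_S = √⟪y, S y⟫`. The norm `‖·‖_{S⁻¹}` is `normOp S.inverse`. -/
def normOp (S : G →L[ℝ] G) (y : G) : ℝ := √⟪y, S y⟫_ℝ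

/-- A positive definite operator is invertible, so that `S.inverse` is its inverse. -/
theorem IsPositiveDefinite.isInvertible {S : G →L[ℝ] G} (hS : IsPositiveDefinite S) :
    S.IsInvertible := by
  obtain ⟨σ, hσ, h⟩ := hS.coercive
  have hc : IsCoercive ((innerSL ℝ).comp S : G →L[ℝ] G →L[ℝ] ℝ) := by
    refine ⟨σ, hσ, fun u => ?_⟩
    have := h u
    simp only [ContinuousLinearMap.comp_apply, innerSL_apply_apply]
    rw [real_inner_comm]
    nlinarith [this]
  refine ⟨hc.continuousLinearEquivOfBilin, ?_⟩
  ext v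
  refine ext_inner_right ℝ fun w => ?_
  simp [hc.continuousLinearEquivOfBilin_apply]

/-- The operator norm `‖M‖_{S⁻¹} = sup_{x ≠ 0} ‖M x‖_{S⁻¹} / ‖x‖`. -/
def opNormInv (S : G →L[ℝ] G) (M : H →L[ℝ] G) : ℝ :=
  ⨆ x : {x : H // x ≠ 0}, normOp S.inverse (M x) / ‖(x : H)‖

/-- The Fenchel-Moreau conjugate `h*(y) = sup_u (⟪u, y⟫ - h u)`. -/
def conj (h : G → EReal) (y : G) : EReal := ⨆ u : G, ((⟪u, y⟫_ℝ : ℝ) : EReal) - h u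

/-- The function `ȳ ↦ ⟪y, ȳ⟫ - h*(ȳ) - (β / 2) ‖ȳ - ẏ‖_S ^ 2`, whose supremum is the `β`-smooth
approximation of `h` at `y`. -/
def smoothObjective (h : G → EReal) (S : G →L[ℝ] G) (ydot : G) (β : ℝ) (y ybar : G) : EReal :=
  ((⟪y, ybar⟫_ℝ : ℝ) : EReal) - conj h ybar - ((β / 2 * normOp S (ybar - ydot) ^ 2 : ℝ) : EReal)

/-- `p = y*_β(y; ẏ)`, the maximizer in the definition of the `β`-smooth approximation of `h`. -/
def IsSmoothArgmax (h : G → EReal) (S : G →L[ℝ] G) (ydot : G) (β : ℝ) (y p : G) : Prop :=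
  ∀ ybar, smoothObjective h S ydot β y ybar ≤ smoothObjective h S ydot β y p

/-- `p = prox_{γ g}(x)`, the minimizer of `z ↦ γ g z + ‖z - x‖ ^ 2 / 2`. -/
def IsProx (γ : ℝ) (g : H → EReal) (x p : H) : Prop :=
  ∀ z, (γ : EReal) * g p + ((1 / 2 * ‖p - x‖ ^ 2 : ℝ) : EReal) ≤
    (γ : EReal) * g z + ((1 / 2 * ‖z - x‖ ^ 2 : ℝ) : EReal)

/-- The sequences `τ, β, B` (`B` is used from index `1` on), `xhat`, `xbar`, `xtil`, `ystar` are
generated by the linearized ASGARD algorithm with initial parameter `β₀`; the starting points are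
`xbar 0` and `xtil 0`. -/
structure IsLinearizedASGARD (f : H → ℝ) (g : H → EReal) (h : G → EReal) (M : H →L[ℝ] G)
    (S : G →L[ℝ] G) (ydot : G) (L β₀ : ℝ) (τ β B : ℕ → ℝ) (xhat xbar xtil : ℕ → H)
    (ystar : ℕ → G) : Prop where
  tau_zero : τ 0 = 1
  beta_zero : β 0 = β₀
  xhat_eq : ∀ k, xhat k = (1 - τ k) • xbar k + τ k • xtil k
  beta_succ : ∀ k, β (k + 1) = β k / (1 + τ k)
  B_succ : ∀ k, B (k + 1) = L + opNormInv S M ^ 2 / β (k + 1)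
  ystar_argmax : ∀ k, IsSmoothArgmax h S ydot (β (k + 1)) (M (xhat k)) (ystar k)
  xtil_succ : ∀ k, IsProx (1 / (τ k * B (k + 1))) g
    (xtil k - (1 / (τ k * B (k + 1))) • (∇ f (xhat k) + M.adjoint (ystar k))) (xtil (k + 1))
  xbar_succ : ∀ k, xbar (k + 1) = xhat k + τ k • (xtil (k + 1) - xtil k)
  tau_succ_pos : ∀ k, 0 < τ (k + 1)
  tau_succ : ∀ k, (B (k + 1) - L) / B (k + 1) * τ (k + 1) ^ 3 + τ (k + 1) ^ 2
    + τ k ^ 2 * τ (k + 1) - τ k ^ 2 = 0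

/-- The primal objective `f + g + h ∘ M`. -/
def primalObj (f : H → ℝ) (g : H → EReal) (h : G → EReal) (M : H →L[ℝ] G) (x : H) : EReal :=
  (f x : EReal) + g x + h (M x)

/-- The set of primal solutions. -/
def primalSolutions (f : H → ℝ) (g : H → EReal) (h : G → EReal) (M : H →L[ℝ] G) : Set H :=
  {x | ∀ z, primalObj f g h M x ≤ primalObj f g h M z}

/-- The Lagrangian `(x, y) ↦ f x + g x + ⟪M x, y⟫ - h*(y)`. -/
def lagrangian (f : H → ℝ) (g : H → EReal) (h : G → EReal) (M : H →L[ℝ] G) (x : H) (y : G) :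
    EReal :=
  (f x : EReal) + g x + ((⟪M x, y⟫_ℝ : ℝ) : EReal) - conj h y

/-- The dual objective. -/
def dualObj (f : H → ℝ) (g : H → EReal) (h : G → EReal) (M : H →L[ℝ] G) (y : G) : EReal :=
  ⨅ x : H, lagrangian f g h M x y

/-- The set of dual solutions. -/
def dualSolutions (f : H → ℝ) (g : H → EReal) (h : G → EReal) (M : H →L[ℝ] G) : Set G :=
  {y | ∀ z, dualObj f g h M z ≤ dualObj f g h M y}

/-- `(x, y)` is a saddle point of the Lagrangian. -/
def IsSaddlePoint (f : H → ℝ) (g : H → EReal) (h : G → EReal) (M : H →L[ℝ] G) (x : H) (y : G) :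
    Prop :=
  ∀ (x' : H) (y' : G), lagrangian f g h M x y' ≤ lagrangian f g h M x y ∧
    lagrangian f g h M x y ≤ lagrangian f g h M x' y

open Classical in
/-- The indicator function of the set `{c}`: zero at `c` and `+∞` elsewhere. -/
def indicatorPoint (c : G) (y : G) : EReal := if y = c then 0 else ⊤

/-- The relative interior of a convex set `C`: the points `x` of `C` such that the cone generated
by `C - x` is the linear span of `C - x`. It contains Mathlib's `intrinsicInterior`, and coincides
with it in finite dimension. -/
def relInterior (C : Set H) : Set H :=
  {x | x ∈ C ∧ ∀ v ∈ vectorSpan ℝ C, ∃ t : ℝ, 0 < t ∧ ∃ z ∈ C, v = t • (z - x)}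

end SmoothASGARD

end

/-
Regularize the Lagrangian to `f x + g x + ⟪M x, y⟫ - h*(y) - (b / 2) ‖y - ẏ‖_S ^ 2`. For fixed `b`,
its supremum over `y` is the objective with `h` replaced by a `1 / b`-smooth approximation, and the
algorithm performs one accelerated proximal gradient step on it. The rule
`β (k + 1) = β k / (1 + τ k)` is what absorbs the change of `b` between two steps, and the equation
for `τ` says that `τ (k + 1) ^ 2 * B (k + 2) = (1 - τ (k + 1)) * (τ k ^ 2 * B (k + 1))`. Hence the
excess over the optimal value of
`regLagrangian (β (k + 1)) (xbar (k + 1)) y + τ k ^ 2 * B (k + 1) / 2 * ‖xtil (k + 1) - xs‖ ^ 2`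
is multiplied by at most `1 - τ k` in step `k`, uniformly in `y`. As `β k ≤ β₀ / (k + 1)` and
`τ k ^ 2 * B (k + 1) ≤ B 1 / (k + 1)`, this bounds the regularized Lagrangian at every `y` by the
optimal value plus `O (1 / k)`.

For an equality constraint, maximizing that bound over `y` controls the infeasibility, because `xs`
minimizes the Lagrangian at `ys`; when no saddle point is given, a Baire category argument in the
closed subspace `M (span (dom g - dom g))` provides a multiplier, so that there is no duality gap.
For Lipschitz `h`, take for `y` a subgradient of `h` at `M (xbar (k + 1))`: its `S`-norm is at most
`D`.
-/

namespace SmoothASGARD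

section Operators

variable {H G : Type*}
  [NormedAddCommGroup H] [InnerProductSpace ℝ H]
  [NormedAddCommGroup G] [InnerProductSpace ℝ G]
  {S : G →L[ℝ] G}

theorem normOp_nonneg (T : G →L[ℝ] G) (y : G) : 0 ≤ normOp T y := Real.sqrt_nonneg _

theorem normOp_le (T : G →L[ℝ] G) (y : G) : normOp T y ≤ √‖T‖ * ‖y‖ := by
  refine Real.sqrt_le_iff.2 ⟨by positivity, ?_⟩
  calc ⟪y, T y⟫_ℝ ≤ ‖y‖ * (‖T‖ * ‖y‖) :=
        (real_inner_le_norm _ _).trans (by gcongr; exact T.le_opNorm y)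
    _ = (√‖T‖ * ‖y‖) ^ 2 := by rw [mul_pow, Real.sq_sqrt (norm_nonneg T)]; ring

theorem normOp_inverse_le (S : G →L[ℝ] G) (M : H →L[ℝ] G) (x : H) :
    normOp S.inverse (M x) ≤ opNormInv S M * ‖x‖ := by
  rcases eq_or_ne x 0 with rfl | hx
  · simp [normOp]
  have hbdd : BddAbove (Set.range fun x : {x : H // x ≠ 0} =>
      normOp S.inverse (M x) / ‖(x : H)‖) := by
    refine ⟨√‖S.inverse‖ * ‖M‖, ?_⟩
    rintro _ ⟨⟨z, hz⟩, rfl⟩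
    refine div_le_of_le_mul₀ (norm_nonneg z) (by positivity) ((normOp_le _ _).trans ?_)
    rw [mul_assoc]
    gcongr
    exact M.le_opNorm z
  exact (div_le_iff₀ (norm_pos_iff.2 hx)).1 (le_ciSup hbdd ⟨x, hx⟩)

namespace IsPositiveDefinite

variable [CompleteSpace G]

theorem apply_inverse (hS : IsPositiveDefinite S) (y : G) : S (S.inverse y) = y :=
  hS.isInvertible.self_apply_inverse y

theorem inverse_apply (hS : IsPositiveDefinite S) (y : G) : S.inverse (S y) = y :=
  hS.isInvertible.inverse_apply_self y

theorem inner_apply_comm (hS : IsPositiveDefinite S) (x y : G) : ⟪x, S y⟫_ℝ = ⟪y, S x⟫_ℝ := by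
  rw [← ContinuousLinearMap.adjoint_inner_left, hS.selfAdjoint.adjoint_eq, real_inner_comm]

theorem inner_apply_self_nonneg (hS : IsPositiveDefinite S) (y : G) : 0 ≤ ⟪y, S y⟫_ℝ := by
  obtain ⟨σ, hσ, hcoercive⟩ := hS.coercive
  exact le_trans (by positivity) (hcoercive y)

theorem normOp_sq (hS : IsPositiveDefinite S) (y : G) : normOp S y ^ 2 = ⟪y, S y⟫_ℝ :=
  Real.sq_sqrt (hS.inner_apply_self_nonneg y)

theorem normOp_pos (hS : IsPositiveDefinite S) {y : G} (hy : y ≠ 0) : 0 < normOp S y := by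
  obtain ⟨σ, hσ, hcoercive⟩ := hS.coercive
  have := norm_pos_iff.2 hy
  exact Real.sqrt_pos.2 (lt_of_lt_of_le (by positivity) (hcoercive y))

theorem normOp_smul_sq (hS : IsPositiveDefinite S) (t : ℝ) (y : G) :
    normOp S (t • y) ^ 2 = t ^ 2 * normOp S y ^ 2 := by
  simp only [hS.normOp_sq, map_smul, real_inner_smul_left, real_inner_smul_right]
  ring

theorem normOp_inverse_apply (hS : IsPositiveDefinite S) (y : G) :
    normOp S.inverse (S y) = normOp S y := by
  rw [normOp, hS.inverse_apply, real_inner_comm, normOp]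

theorem normOp_apply_inverse (hS : IsPositiveDefinite S) (y : G) :
    normOp S (S.inverse y) = normOp S.inverse y := by
  rw [← hS.normOp_inverse_apply, hS.apply_inverse]

theorem inner_inverse_self (hS : IsPositiveDefinite S) (y : G) :
    ⟪y, S.inverse y⟫_ℝ = normOp S.inverse y ^ 2 := by
  rw [← hS.normOp_apply_inverse, hS.normOp_sq, hS.apply_inverse, real_inner_comm]

/- Cauchy–Schwarz for the form `⟪·, S ·⟫` at `z` and `S⁻¹ w`. -/
theorem abs_inner_le (hS : IsPositiveDefinite S) (w z : G) :
    |⟪w, z⟫_ℝ| ≤ normOp S z * normOp S.inverse w := by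
  have hsymm : LinearMap.IsSymm ((innerₗ G).compl₂ (S : G →ₗ[ℝ] G)) :=
    ⟨fun x y => hS.inner_apply_comm x y⟩
  have hcs := LinearMap.BilinForm.apply_sq_le_of_symm _ hS.inner_apply_self_nonneg hsymm
    z (S.inverse w)
  refine abs_le_of_sq_le_sq ?_ (mul_nonneg (normOp_nonneg _ _) (normOp_nonneg _ _))
  rw [mul_pow, hS.normOp_sq, ← hS.normOp_apply_inverse w, hS.normOp_sq]
  simpa [hS.apply_inverse, real_inner_comm] using hcs

theorem inner_le_half_add_half (hS : IsPositiveDefinite S) (w z : G) {b : ℝ} (hb : 0 < b) :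
    ⟪w, z⟫_ℝ ≤ b / 2 * normOp S z ^ 2 + 1 / (2 * b) * normOp S.inverse w ^ 2 := by
  have hsq : 0 ≤ (b * normOp S z - normOp S.inverse w) ^ 2 / (2 * b) := by positivity
  calc ⟪w, z⟫_ℝ ≤ normOp S z * normOp S.inverse w := (le_abs_self _).trans (hS.abs_inner_le w z)
    _ ≤ normOp S z * normOp S.inverse w + (b * normOp S z - normOp S.inverse w) ^ 2 / (2 * b) :=
        le_add_of_nonneg_right hsq
    _ = _ := by field_simp; ring

theorem normOp_sub_sq_le (hS : IsPositiveDefinite S) (y z : G) :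
    normOp S (y - z) ^ 2 ≤ 2 * (normOp S y ^ 2 + normOp S z ^ 2) := by
  have hpos := hS.inner_apply_self_nonneg (y + z)
  simp only [hS.normOp_sq, map_sub, map_add, inner_sub_left, inner_sub_right, inner_add_left,
    inner_add_right] at hpos ⊢
  linarith

theorem opNormInv_pos (hS : IsPositiveDefinite S) {M : H →L[ℝ] G} (hM : M ≠ 0) :
    0 < opNormInv S M := by
  obtain ⟨x, hx⟩ := DFunLike.exists_ne hM
  have hinv : S.inverse (M x) ≠ 0 := fun h0 => hx (by
    rw [← hS.apply_inverse (M x), h0, map_zero, zero_apply])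
  have hpos := hS.normOp_pos hinv
  rw [hS.normOp_apply_inverse] at hpos
  exact pos_of_mul_pos_left (hpos.trans_le (normOp_inverse_le S M x)) (norm_nonneg x)

end IsPositiveDefinite

end Operators

section Convexity

theorem add_bilin_le_of_isMinOn {E : Type*} [AddCommGroup E] [Module ℝ E] {C : Set E}
    {φ : E → ℝ} (hφ : ConvexOn ℝ C φ) (B : LinearMap.BilinForm ℝ E) {a p z : E} (hp : p ∈ C)
    (hmin : IsMinOn (fun z => φ z + B (z - a) (z - a)) C p) (hz : z ∈ C) :
    φ p + B (p - a) (p - a) + B (z - p) (z - p) ≤ φ z + B (z - a) (z - a) := by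
  set cross := B (p - a) (z - p) + B (z - p) (p - a) with hcross
  have hline : ∀ t ∈ Set.Ioo (0 : ℝ) 1, φ p ≤ φ z + cross + t * B (z - p) (z - p) := by
    rintro t ⟨ht0, ht1⟩
    have hconv := hφ.2 hp hz (sub_nonneg.2 ht1.le) ht0.le (sub_add_cancel 1 t)
    have hle := hmin (hφ.1 hp hz (sub_nonneg.2 ht1.le) ht0.le (sub_add_cancel 1 t))
    have hsub : (1 - t) • p + t • z - a = (p - a) + t • (z - p) := by module
    simp only [Set.mem_ofPred_eq, hsub, map_add, map_smul, LinearMap.add_apply,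
      LinearMap.smul_apply, smul_eq_mul] at hle hconv
    refine le_of_mul_le_mul_left (a := t) ?_ ht0
    linarith
  have hlim : Filter.Tendsto (fun t : ℝ => φ z + cross + t * B (z - p) (z - p))
      (nhdsWithin 0 (Set.Ioi 0)) (nhds (φ z + cross + 0 * B (z - p) (z - p))) :=
    ((by fun_prop : Continuous fun t : ℝ => φ z + cross + t * B (z - p) (z - p)).tendsto
      0).mono_left nhdsWithin_le_nhds
  have hfirst := ge_of_tendsto hlim (Filter.mem_of_superset (Ioo_mem_nhdsGT one_pos) hline)
  have hexpand : B (z - a) (z - a) = B (p - a) (p - a) + cross + B (z - p) (z - p) := by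
    rw [← sub_add_sub_cancel z p a]
    simp only [map_add, LinearMap.add_apply, hcross]
    ring
  linarith

theorem add_fderiv_sub_le_of_convexOn {E : Type*} [NormedAddCommGroup E] [NormedSpace ℝ E]
    {C : Set E} {f : E → ℝ} {f' : StrongDual ℝ E} (hf : ConvexOn ℝ C f) {x y : E} (hx : x ∈ C)
    (hy : y ∈ C) (hf' : HasFDerivAt f f' x) : f x + f' (y - x) ≤ f y := by
  have hline : HasDerivAt (f ∘ AffineMap.lineMap (k := ℝ) x y) (f' (y - x)) 0 :=
    HasFDerivAt.comp_hasDerivAt (0 : ℝ) (by simpa using hf') AffineMap.hasDerivAt_lineMap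
  have hslope := (hf.comp_affineMap (AffineMap.lineMap (k := ℝ) x y)).le_slope_of_hasDerivAt
    (x := 0) (y := 1) (by simpa using hx) (by simpa using hy) one_pos hline
  simp only [slope, sub_zero, inv_one, one_smul, vsub_eq_sub, Function.comp_apply,
    AffineMap.lineMap_apply_zero, AffineMap.lineMap_apply_one] at hslope
  linarith

theorem IsConvexWithLipschitzGradient.add_inner_le {H : Type*} [NormedAddCommGroup H]
    [InnerProductSpace ℝ H] [CompleteSpace H] {f : H → ℝ} {L : ℝ}
    (hf : IsConvexWithLipschitzGradient f L) (x y : H) :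
    f x + ⟪y - x, ∇ f x⟫_ℝ ≤ f y := by
  rw [inner_gradient_right]
  exact add_fderiv_sub_le_of_convexOn hf.convex (Set.mem_univ x) (Set.mem_univ y)
    (hf.differentiable x).hasFDerivAt

end Convexity

section ExtendedReal

section Domain

variable {E : Type*} {φ : E → EReal}

theorem coe_toReal_of_mem_dom (hbot : ∀ x, φ x ≠ ⊥) {x : E} (hx : x ∈ dom φ) :
    ((φ x).toReal : EReal) = φ x :=
  EReal.coe_toReal (ne_of_lt hx) (hbot x)

theorem eq_top_of_notMem_dom {x : E} (hx : x ∉ dom φ) : φ x = ⊤ :=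
  not_lt_top_iff.1 hx

theorem le_coe_iff (hbot : ∀ x, φ x ≠ ⊥) {x : E} {r : ℝ} :
    φ x ≤ (r : EReal) ↔ x ∈ dom φ ∧ (φ x).toReal ≤ r := by
  constructor
  · intro hle
    have hx : x ∈ dom φ := hle.trans_lt (EReal.coe_lt_top r)
    exact ⟨hx, by rwa [← EReal.coe_le_coe_iff, coe_toReal_of_mem_dom hbot hx]⟩
  · rintro ⟨hx, hle⟩
    rwa [← coe_toReal_of_mem_dom hbot hx, EReal.coe_le_coe_iff]

theorem convexOn_toReal [AddCommGroup E] [Module ℝ E] (hbot : ∀ x, φ x ≠ ⊥)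
    (hconv : Convex ℝ {p : E × ℝ | φ p.1 ≤ (p.2 : EReal)}) :
    ConvexOn ℝ (dom φ) fun x => (φ x).toReal :=
  convexOn_of_convex_epigraph (by simpa only [le_coe_iff hbot] using hconv)

theorem isClosed_sublevel_add [TopologicalSpace E] (hbot : ∀ x, φ x ≠ ⊥)
    (hlsc : LowerSemicontinuous φ) {f : E → ℝ} (hf : Continuous f) (r : ℝ) :
    IsClosed {x | x ∈ dom φ ∧ f x + (φ x).toReal ≤ r} := by
  have hpre : IsClosed ((fun x => (x, ((r - f x : ℝ) : EReal))) ⁻¹'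
      {p : E × EReal | φ p.1 ≤ p.2}) :=
    hlsc.isClosed_epigraph.preimage
      (continuous_id.prodMk (continuous_coe_real_ereal.comp (by fun_prop)))
  simpa only [Set.preimage_ofPred_eq, le_coe_iff hbot, le_sub_iff_add_le'] using hpre

end Domain

section Conjugate

variable {G : Type*} [NormedAddCommGroup G] [InnerProductSpace ℝ G] {h : G → EReal}

theorem conj_le_coe_iff (hbot : ∀ x, h x ≠ ⊥) {y : G} {r : ℝ} :
    conj h y ≤ (r : EReal) ↔ ∀ u ∈ dom h, ⟪u, y⟫_ℝ - (h u).toReal ≤ r := by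
  rw [conj, iSup_le_iff]
  refine forall_congr' fun u => ?_
  by_cases hu : u ∈ dom h
  · rw [← coe_toReal_of_mem_dom hbot hu, ← EReal.coe_sub, EReal.coe_le_coe_iff,
      EReal.toReal_coe, forall_prop_of_true hu]
  · simp [hu, eq_top_of_notMem_dom hu]

theorem conj_ne_bot (hne : (dom h).Nonempty) (y : G) : conj h y ≠ ⊥ := by
  obtain ⟨u, hu⟩ := hne
  refine ne_bot_of_le_ne_bot ?_ (le_iSup (fun u => ((⟪u, y⟫_ℝ : ℝ) : EReal) - h u) u)
  simpa [sub_eq_add_neg, EReal.add_eq_bot_iff] using (show h u < ⊤ from hu).ne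

theorem inner_sub_conj_le (hbot : ∀ x, h x ≠ ⊥) {u y : G} (hu : u ∈ dom h)
    (hy : y ∈ dom (conj h)) : ⟪u, y⟫_ℝ - (conj h y).toReal ≤ (h u).toReal := by
  have hle := coe_toReal_of_mem_dom (conj_ne_bot ⟨u, hu⟩) hy
  linarith [(conj_le_coe_iff hbot).1 hle.ge u hu]

theorem convexOn_conj (hbot : ∀ x, h x ≠ ⊥) (hne : (dom h).Nonempty) :
    ConvexOn ℝ (dom (conj h)) fun y => (conj h y).toReal := by
  refine convexOn_toReal (conj_ne_bot hne) ?_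
  rintro ⟨y, r⟩ hy ⟨z, s⟩ hz a b ha hb hab
  simp only [Set.mem_ofPred_eq, Prod.smul_mk, Prod.mk_add_mk, smul_eq_mul] at hy hz ⊢
  rw [conj_le_coe_iff hbot] at hy hz ⊢
  intro u hu
  calc ⟪u, a • y + b • z⟫_ℝ - (h u).toReal
      = a * (⟪u, y⟫_ℝ - (h u).toReal) + b * (⟪u, z⟫_ℝ - (h u).toReal) := by
        rw [inner_add_right, real_inner_smul_right, real_inner_smul_right]
        linear_combination (h u).toReal * hab
    _ ≤ a * r + b * s := by gcongr; exacts [hy u hu, hz u hu]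

end Conjugate

section Argmin

variable {H G : Type*} [NormedAddCommGroup H]
  [NormedAddCommGroup G] [InnerProductSpace ℝ G] {g : H → EReal} {h : G → EReal}
  {S : G →L[ℝ] G} {ydot u p : G} {b γ : ℝ} {x q : H}

theorem smoothObjective_eq_coe (hne : (dom h).Nonempty) {y : G} (hy : y ∈ dom (conj h)) :
    smoothObjective h S ydot b u y =
      ((⟪u, y⟫_ℝ - (conj h y).toReal - b / 2 * normOp S (y - ydot) ^ 2 : ℝ) : EReal) := by
  rw [smoothObjective, EReal.coe_sub, EReal.coe_sub, coe_toReal_of_mem_dom (conj_ne_bot hne) hy]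

theorem IsSmoothArgmax.mem_dom (hp : IsSmoothArgmax h S ydot b u p) (hne : (dom h).Nonempty)
    (hne' : (dom (conj h)).Nonempty) : p ∈ dom (conj h) := by
  obtain ⟨y, hy⟩ := hne'
  by_contra hpn
  have hle := hp y
  rw [smoothObjective_eq_coe hne hy, smoothObjective, eq_top_of_notMem_dom hpn,
    EReal.sub_top, EReal.bot_sub, le_bot_iff] at hle
  exact EReal.coe_ne_bot _ hle

theorem IsSmoothArgmax.le_of_mem_dom (hp : IsSmoothArgmax h S ydot b u p)
    (hne : (dom h).Nonempty) {y : G} (hy : y ∈ dom (conj h)) :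
    ⟪u, y⟫_ℝ - (conj h y).toReal - b / 2 * normOp S (y - ydot) ^ 2 ≤
      ⟪u, p⟫_ℝ - (conj h p).toReal - b / 2 * normOp S (p - ydot) ^ 2 := by
  have hle := hp y
  rwa [smoothObjective_eq_coe hne hy, smoothObjective_eq_coe hne (hp.mem_dom hne ⟨y, hy⟩),
    EReal.coe_le_coe_iff] at hle

theorem IsProx.mem_dom (hq : IsProx γ g x q) (hγ : 0 < γ) (hne : (dom g).Nonempty) :
    q ∈ dom g := by
  obtain ⟨z, hz⟩ := hne
  by_contra hqn
  have hle := hq z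
  rw [eq_top_of_notMem_dom hqn, EReal.coe_mul_top_of_pos hγ, EReal.top_add_coe,
    top_le_iff] at hle
  refine EReal.add_ne_top ((EReal.mul_ne_top _ _).2 ?_) (EReal.coe_ne_top _) hle
  simp [hγ.le, (show g z < ⊤ from hz).ne]

theorem IsProx.isMinOn (hq : IsProx γ g x q) (hγ : 0 < γ) (hbot : ∀ z, g z ≠ ⊥) :
    IsMinOn (fun z => (g z).toReal + 1 / (2 * γ) * ‖z - x‖ ^ 2) (dom g) q := by
  intro z hz
  have hle := hq z
  rw [← coe_toReal_of_mem_dom hbot hz,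
    ← coe_toReal_of_mem_dom hbot (hq.mem_dom hγ ⟨z, hz⟩)] at hle
  norm_cast at hle
  have hscale : ∀ y, (g y).toReal + 1 / (2 * γ) * ‖y - x‖ ^ 2 =
      γ⁻¹ * (γ * (g y).toReal + 1 / 2 * ‖y - x‖ ^ 2) := fun y => by field_simp
  simp only [Set.mem_ofPred_eq, hscale]
  gcongr

end Argmin

end ExtendedReal

section StepSizes

theorem cubic_root_lt_one {c s t : ℝ} (hc : 0 ≤ c) (ht : 0 < t)
    (hroot : c * t ^ 3 + t ^ 2 + s ^ 2 * t - s ^ 2 = 0) : t < 1 := by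
  by_contra! hle
  have hcube : 0 ≤ c * t ^ 3 := by positivity
  nlinarith [mul_nonneg (sq_nonneg s) (sub_nonneg.2 hle)]

/- Otherwise `t < s (1 - t)`, so that `t² < s² (1 - t)² = (1 - t) (c t³ + t²) ≤ t² (1 - t²)`. -/
theorem le_mul_one_add_of_cubic_root {c s t : ℝ} (hc : c ≤ 1) (ht : 0 < t) (ht1 : t < 1)
    (hroot : c * t ^ 3 + t ^ 2 + s ^ 2 * t - s ^ 2 = 0) : s ≤ t * (1 + s) := by
  by_contra! hlt
  have hlt' : t < s * (1 - t) := by linarith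
  have hcontra : t ^ 2 < t ^ 2 * (1 - t ^ 2) :=
    calc t ^ 2 < (s * (1 - t)) ^ 2 := by gcongr
      _ = (1 - t) * (c * t ^ 3 + t ^ 2) := by linear_combination -(1 - t) * hroot
      _ ≤ (1 - t) * (1 * t ^ 3 + t ^ 2) := by
        have := sub_pos.2 ht1
        gcongr
      _ = t ^ 2 * (1 - t ^ 2) := by ring
  nlinarith [pow_pos ht 4]

/-- The parameters `τ, β, B` of the algorithm, with `L` the smoothness constant and `A` standing
for `‖M‖_{S⁻¹} ^ 2`. As in `IsLinearizedASGARD`, the sequence `B` is used from index `1` on. -/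
structure IsStepSizes (L A β₀ : ℝ) (τ β B : ℕ → ℝ) : Prop where
  smoothness_nonneg : 0 ≤ L
  opNorm_sq_nonneg : 0 ≤ A
  add_pos : 0 < L + A
  initial_pos : 0 < β₀
  tau_zero : τ 0 = 1
  beta_zero : β 0 = β₀
  beta_succ : ∀ k, β (k + 1) = β k / (1 + τ k)
  B_succ : ∀ k, B (k + 1) = L + A / β (k + 1)
  tau_succ_pos : ∀ k, 0 < τ (k + 1)
  tau_succ : ∀ k, (B (k + 1) - L) / B (k + 1) * τ (k + 1) ^ 3 + τ (k + 1) ^ 2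
    + τ k ^ 2 * τ (k + 1) - τ k ^ 2 = 0

namespace IsStepSizes

variable {L A β₀ : ℝ} {τ β B : ℕ → ℝ}

theorem tau_pos (hs : IsStepSizes L A β₀ τ β B) : ∀ k, 0 < τ k
  | 0 => hs.tau_zero ▸ one_pos
  | k + 1 => hs.tau_succ_pos k

theorem beta_pos (hs : IsStepSizes L A β₀ τ β B) (k : ℕ) : 0 < β k := by
  induction k with
  | zero => exact hs.beta_zero ▸ hs.initial_pos
  | succ k ih =>
    have := hs.tau_pos k
    rw [hs.beta_succ]
    positivity

theorem one_add_tau_mul_beta_succ (hs : IsStepSizes L A β₀ τ β B) (k : ℕ) :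
    (1 + τ k) * β (k + 1) = β k := by
  have := hs.tau_pos k
  rw [hs.beta_succ, mul_div_cancel₀ _ (by positivity)]

theorem B_sub_nonneg (hs : IsStepSizes L A β₀ τ β B) (k : ℕ) : 0 ≤ B (k + 1) - L := by
  rw [hs.B_succ, add_sub_cancel_left]
  exact div_nonneg hs.opNorm_sq_nonneg (hs.beta_pos _).le

theorem B_pos (hs : IsStepSizes L A β₀ τ β B) (k : ℕ) : 0 < B (k + 1) := by
  have hβ := hs.beta_pos (k + 1)
  rw [hs.B_succ]
  rcases hs.smoothness_nonneg.eq_or_lt with hL | hL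
  · have hA := hs.add_pos
    rw [← hL, zero_add] at hA ⊢
    positivity
  · have := div_nonneg hs.opNorm_sq_nonneg hβ.le
    positivity

theorem tau_le_one (hs : IsStepSizes L A β₀ τ β B) : ∀ k, τ k ≤ 1
  | 0 => hs.tau_zero.le
  | k + 1 => (cubic_root_lt_one (div_nonneg (hs.B_sub_nonneg k) (hs.B_pos k).le)
      (hs.tau_succ_pos k) (hs.tau_succ k)).le

theorem tau_le_mul_one_add (hs : IsStepSizes L A β₀ τ β B) (k : ℕ) :
    τ k ≤ τ (k + 1) * (1 + τ k) := by
  have hratio := div_nonneg (hs.B_sub_nonneg k) (hs.B_pos k).le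
  refine le_mul_one_add_of_cubic_root ?_ (hs.tau_succ_pos k)
    (cubic_root_lt_one hratio (hs.tau_succ_pos k) (hs.tau_succ k)) (hs.tau_succ k)
  exact (div_le_one (hs.B_pos k)).2 (sub_le_self _ hs.smoothness_nonneg)

theorem one_div_le_tau (hs : IsStepSizes L A β₀ τ β B) (k : ℕ) : 1 / ((k : ℝ) + 1) ≤ τ k := by
  induction k with
  | zero => simp [hs.tau_zero]
  | succ k ih =>
    have hτ := hs.tau_pos k
    rw [div_le_iff₀ (by positivity)] at ih
    push_cast
    calc 1 / ((k : ℝ) + 1 + 1) ≤ τ k / (1 + τ k) := by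
          rw [div_le_div_iff₀ (by positivity) (by positivity)]
          linarith
      _ ≤ τ (k + 1) := (div_le_iff₀ (by positivity)).2 (hs.tau_le_mul_one_add k)

theorem tau_sq_mul_B_succ (hs : IsStepSizes L A β₀ τ β B) (k : ℕ) :
    τ (k + 1) ^ 2 * B (k + 2) = (1 - τ (k + 1)) * (τ k ^ 2 * B (k + 1)) := by
  have hB := (hs.B_pos k).ne'
  have hβ := (hs.beta_pos (k + 1)).ne'
  have hsucc : B (k + 2) = B (k + 1) + τ (k + 1) * (B (k + 1) - L) := by
    rw [hs.B_succ (k + 1), hs.beta_succ (k + 1), hs.B_succ k]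
    field_simp
    ring
  have hroot := hs.tau_succ k
  field_simp at hroot
  rw [hsucc]
  linear_combination hroot

theorem tau_sq_mul_B_le (hs : IsStepSizes L A β₀ τ β B) (k : ℕ) :
    τ k ^ 2 * B (k + 1) ≤ 1 / ((k : ℝ) + 1) * B 1 := by
  induction k with
  | zero => simp [hs.tau_zero]
  | succ k ih =>
    have hτ := hs.one_div_le_tau (k + 1)
    have hτ1 := sub_nonneg.2 (hs.tau_le_one (k + 1))
    have hB := hs.B_pos 0
    rw [hs.tau_sq_mul_B_succ]
    push_cast at hτ ⊢
    calc (1 - τ (k + 1)) * (τ k ^ 2 * B (k + 1))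
        ≤ (1 - τ (k + 1)) * (1 / ((k : ℝ) + 1) * B 1) := by gcongr
      _ ≤ (1 - 1 / ((k : ℝ) + 1 + 1)) * (1 / ((k : ℝ) + 1) * B 1) := by gcongr
      _ = _ := by field_simp; ring

theorem beta_le (hs : IsStepSizes L A β₀ τ β B) (k : ℕ) : β k ≤ β₀ / ((k : ℝ) + 1) := by
  have hβ₀ := hs.initial_pos
  induction k with
  | zero => simp [hs.beta_zero]
  | succ k ih =>
    have hτ := hs.one_div_le_tau k
    rw [hs.beta_succ]
    push_cast
    calc β k / (1 + τ k) ≤ (β₀ / ((k : ℝ) + 1)) / (1 + 1 / ((k : ℝ) + 1)) := by gcongr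
      _ = _ := by field_simp

theorem beta_succ_le (hs : IsStepSizes L A β₀ τ β B) (k : ℕ) :
    β (k + 1) ≤ β₀ / ((k : ℝ) + 1) := by
  have hβ₀ := hs.initial_pos
  refine (hs.beta_le (k + 1)).trans ?_
  push_cast
  gcongr
  linarith

end IsStepSizes

theorem IsLinearizedASGARD.isStepSizes {H G : Type*}
    [NormedAddCommGroup H] [InnerProductSpace ℝ H] [CompleteSpace H]
    [NormedAddCommGroup G] [InnerProductSpace ℝ G] [CompleteSpace G]
    {f : H → ℝ} {g : H → EReal} {h : G → EReal} {M : H →L[ℝ] G} {S : G →L[ℝ] G} {ydot : G}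
    {L β₀ : ℝ} {τ β B : ℕ → ℝ} {xhat xbar xtil : ℕ → H} {ystar : ℕ → G}
    (halg : IsLinearizedASGARD f g h M S ydot L β₀ τ β B xhat xbar xtil ystar)
    (hS : IsPositiveDefinite S) (hL : 0 ≤ L) (hLM : 0 < L ∨ M ≠ 0) (hβ₀ : 0 < β₀) :
    IsStepSizes L (opNormInv S M ^ 2) β₀ τ β B where
  smoothness_nonneg := hL
  opNorm_sq_nonneg := sq_nonneg _
  add_pos := by
    rcases hLM with hL0 | hM
    · positivity
    · have := hS.opNormInv_pos hM
      positivity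
  initial_pos := hβ₀
  tau_zero := halg.tau_zero
  beta_zero := halg.beta_zero
  beta_succ := halg.beta_succ
  B_succ := halg.B_succ
  tau_succ_pos := halg.tau_succ_pos
  tau_succ := halg.tau_succ

end StepSizes

section OneStep

variable {H G : Type*} [NormedAddCommGroup H] [InnerProductSpace ℝ H]
  [NormedAddCommGroup G] [InnerProductSpace ℝ G] {f : H → ℝ} {g : H → EReal} {h : G → EReal}
  {M : H →L[ℝ] G} {S : G →L[ℝ] G} {ydot : G} {L b : ℝ}

/-- The Lagrangian regularized by `-(b / 2) ‖y - ẏ‖_S ^ 2`, as a real number; its supremum over `y`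
is the primal objective with `h` replaced by its `b`-smooth approximation. Because of `toReal` it is
meaningful only for `x ∈ dom g` and `y ∈ dom (conj h)`. -/
noncomputable def regLagrangian (f : H → ℝ) (g : H → EReal) (h : G → EReal) (M : H →L[ℝ] G)
    (S : G →L[ℝ] G) (ydot : G) (b : ℝ) (x : H) (y : G) : ℝ :=
  f x + (g x).toReal + ⟪M x, y⟫_ℝ - (conj h y).toReal - b / 2 * normOp S (y - ydot) ^ 2

theorem regLagrangian_anti {b b' : ℝ} (hb : b ≤ b') (x : H) (y : G) :
    regLagrangian f g h M S ydot b' x y ≤ regLagrangian f g h M S ydot b x y := by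
  unfold regLagrangian
  gcongr

theorem IsProx.three_point_le {r : ℝ} {z z' w xs : H} (hz' : IsProx r g (z - r • w) z')
    (hr : 0 < r) (hbot : ∀ x, g x ≠ ⊥) (hconv : ConvexOn ℝ (dom g) fun x => (g x).toReal)
    (hxs : xs ∈ dom g) :
    (g z').toReal + ⟪z' - xs, w⟫_ℝ + 1 / (2 * r) * ‖z' - z‖ ^ 2 + 1 / (2 * r) * ‖z' - xs‖ ^ 2 ≤
      (g xs).toReal + 1 / (2 * r) * ‖z - xs‖ ^ 2 := by
  have hform : ∀ v : H, ((1 / (2 * r)) • innerₗ H) v v = 1 / (2 * r) * ‖v‖ ^ 2 := fun v => by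
    simp
  have hexpand : ∀ v : H, 1 / (2 * r) * ‖v - (z - r • w)‖ ^ 2 =
      1 / (2 * r) * ‖v - z‖ ^ 2 + ⟪v - z, w⟫_ℝ + r / 2 * ‖w‖ ^ 2 := fun v => by
    rw [← sub_add, norm_add_sq_real, real_inner_smul_right, norm_smul, mul_pow, Real.norm_eq_abs,
      sq_abs]
    field_simp
  have hgrowth := add_bilin_le_of_isMinOn hconv ((1 / (2 * r)) • innerₗ H)
    (hz'.mem_dom hr ⟨xs, hxs⟩) (by simpa only [hform] using hz'.isMinOn hr hbot) hxs
  have hsplit : ⟪z' - xs, w⟫_ℝ = ⟪z' - z, w⟫_ℝ - ⟪xs - z, w⟫_ℝ := by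
    rw [← inner_sub_left, sub_sub_sub_cancel_right]
  rw [hform, hform, hform, hexpand, hexpand, norm_sub_rev xs z, norm_sub_rev xs z'] at hgrowth
  linarith

variable [CompleteSpace G]

theorem IsSmoothArgmax.le_add_normOp_inverse_sq {u u' p y : G}
    (hp : IsSmoothArgmax h S ydot b u p) (hS : IsPositiveDefinite S) (hb : 0 < b)
    (hbot : ∀ x, h x ≠ ⊥) (hne : (dom h).Nonempty) (hy : y ∈ dom (conj h)) :
    ⟪u', y⟫_ℝ - (conj h y).toReal - b / 2 * normOp S (y - ydot) ^ 2 ≤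
      ⟪u', p⟫_ℝ - (conj h p).toReal - b / 2 * normOp S (p - ydot) ^ 2
        + 1 / (2 * b) * normOp S.inverse (u' - u) ^ 2 := by
  have hform : ∀ v : G, ((b / 2) • (innerₗ G).compl₂ (S : G →ₗ[ℝ] G)) v v =
      b / 2 * normOp S v ^ 2 := fun v => by simp [hS.normOp_sq]
  have hconj := convexOn_conj hbot hne
  have hgrowth := add_bilin_le_of_isMinOn (φ := fun y => (conj h y).toReal - ⟪u, y⟫_ℝ) (a := ydot)
    (hconj.sub ((innerₛₗ ℝ u).concaveOn hconj.1)) ((b / 2) • (innerₗ G).compl₂ (S : G →ₗ[ℝ] G))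
    (hp.mem_dom hne ⟨y, hy⟩)
    (fun z hz => by
      simp only [hform, Set.mem_ofPred_eq]
      linarith [hp.le_of_mem_dom hne hz]) hy
  have hyoung := hS.inner_le_half_add_half (u' - u) (y - p) hb
  simp only [inner_sub_left, inner_sub_right] at hyoung
  rw [hform, hform, hform] at hgrowth
  linarith

variable [CompleteSpace H]

theorem IsConvexWithLipschitzGradient.linearization_le (hf : IsConvexWithLipschitzGradient f L)
    {t : ℝ} (ht : 0 ≤ t) (ht1 : t ≤ 1) (xhat x z xs : H) :
    f xhat + ⟪((1 - t) • x + t • z) - xhat, ∇ f xhat⟫_ℝ ≤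
      (1 - t) * f x + t * (f xs + ⟪z - xs, ∇ f xhat⟫_ℝ) := by
  have hdecomp : ((1 - t) • x + t • z) - xhat =
      (1 - t) • (x - xhat) + t • ((xs - xhat) + (z - xs)) := by module
  have hx := mul_le_mul_of_nonneg_left (hf.add_inner_le xhat x) (sub_nonneg.2 ht1)
  have hxs := mul_le_mul_of_nonneg_left (hf.add_inner_le xhat xs) ht
  rw [hdecomp, inner_add_left, real_inner_smul_left, real_inner_smul_left, inner_add_left]
  linarith

theorem regLagrangian_le_linearization (hf : IsConvexWithLipschitzGradient f L)
    (hS : IsPositiveDefinite S) (hb : 0 < b) (hbot : ∀ x, h x ≠ ⊥) (hne : (dom h).Nonempty)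
    {xhat : H} {p y : G} (hp : IsSmoothArgmax h S ydot b (M xhat) p) (hy : y ∈ dom (conj h))
    (x : H) :
    regLagrangian f g h M S ydot b x y ≤
      f xhat + ⟪x - xhat, ∇ f xhat⟫_ℝ + (g x).toReal + ⟪M x, p⟫_ℝ - (conj h p).toReal
        - b / 2 * normOp S (p - ydot) ^ 2
        + (L + opNormInv S M ^ 2 / b) / 2 * ‖x - xhat‖ ^ 2 := by
  have hsmooth := hf.le_quadratic x xhat
  have hdual := hp.le_add_normOp_inverse_sq (u' := M x) hS hb hbot hne hy
  have hop : 1 / (2 * b) * normOp S.inverse (M x - M xhat) ^ 2 ≤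
      opNormInv S M ^ 2 / b / 2 * ‖x - xhat‖ ^ 2 :=
    calc 1 / (2 * b) * normOp S.inverse (M x - M xhat) ^ 2
        ≤ 1 / (2 * b) * (opNormInv S M * ‖x - xhat‖) ^ 2 := by
          gcongr
          · exact normOp_nonneg _ _
          · rw [← map_sub]
            exact normOp_inverse_le S M _
      _ = _ := by field_simp
  unfold regLagrangian
  linarith

theorem regLagrangian_accelerated_step (hf : IsConvexWithLipschitzGradient f L)
    (hgbot : ∀ x, g x ≠ ⊥) (hgconv : ConvexOn ℝ (dom g) fun x => (g x).toReal)
    (hhbot : ∀ u, h u ≠ ⊥) (hS : IsPositiveDefinite S) {t K : ℝ} (hb : 0 < b) (ht : 0 < t)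
    (ht1 : t ≤ 1) (hK : K = L + opNormInv S M ^ 2 / b) (hK0 : 0 < K) {xhat x z x' z' xs : H}
    {p y : G} (hxhat : xhat = (1 - t) • x + t • z) (hx' : x' = (1 - t) • x + t • z')
    (hp : IsSmoothArgmax h S ydot b (M xhat) p)
    (hz' : IsProx (1 / (t * K)) g (z - (1 / (t * K)) • (∇ f xhat + M.adjoint p)) z')
    (hgx' : (g x').toReal ≤ (1 - t) * (g x).toReal + t * (g z').toReal)
    (hxs : xs ∈ dom g) (hMxs : M xs ∈ dom h) (hy : y ∈ dom (conj h)) :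
    regLagrangian f g h M S ydot b x' y + t ^ 2 * K / 2 * ‖z' - xs‖ ^ 2 ≤
      (1 - t) * regLagrangian f g h M S ydot ((1 + t) * b) x p
        + t * (f xs + (g xs).toReal + (h (M xs)).toReal) + t ^ 2 * K / 2 * ‖z - xs‖ ^ 2 := by
  have hdescent := regLagrangian_le_linearization (g := g) hf hS hb hhbot ⟨M xs, hMxs⟩ hp hy x'
  have hlin := hf.linearization_le ht.le ht1 xhat x z' xs
  rw [← hx'] at hlin
  have hprox := mul_le_mul_of_nonneg_left
    (hz'.three_point_le (by positivity) hgbot hgconv hxs) ht.le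
  rw [show 1 / (2 * (1 / (t * K))) = t * K / 2 by field_simp, inner_add_right,
    ContinuousLinearMap.adjoint_inner_right, map_sub, inner_sub_left (M z')] at hprox
  have hfenchel := mul_le_mul_of_nonneg_left
    (inner_sub_conj_le hhbot hMxs (hp.mem_dom ⟨M xs, hMxs⟩ ⟨y, hy⟩)) ht.le
  have hstep : ‖x' - xhat‖ ^ 2 = t ^ 2 * ‖z' - z‖ ^ 2 := by
    rw [hx', hxhat, add_sub_add_left_eq_sub, ← smul_sub, norm_smul, mul_pow, Real.norm_eq_abs,
      sq_abs]
  have hMx' : ⟪M x', p⟫_ℝ = (1 - t) * ⟪M x, p⟫_ℝ + t * ⟪M z', p⟫_ℝ := by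
    rw [hx', map_add, map_smul, map_smul, inner_add_left, real_inner_smul_left,
      real_inner_smul_left]
  have hreg : 0 ≤ t ^ 2 * (b / 2 * normOp S (p - ydot) ^ 2) := by positivity
  rw [← hK, hstep, hMx'] at hdescent
  simp only [regLagrangian] at hdescent ⊢
  linarith

end OneStep

namespace IsLinearizedASGARD

variable {H G : Type*}
  [NormedAddCommGroup H] [InnerProductSpace ℝ H] [CompleteSpace H]
  [NormedAddCommGroup G] [InnerProductSpace ℝ G] [CompleteSpace G]
  {f : H → ℝ} {g : H → EReal} {h : G → EReal} {M : H →L[ℝ] G} {S : G →L[ℝ] G} {ydot : G}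
  {L β₀ : ℝ} {τ β B : ℕ → ℝ} {xhat xbar xtil : ℕ → H} {ystar : ℕ → G}

theorem xbar_succ_eq (halg : IsLinearizedASGARD f g h M S ydot L β₀ τ β B xhat xbar xtil ystar)
    (k : ℕ) : xbar (k + 1) = (1 - τ k) • xbar k + τ k • xtil (k + 1) := by
  rw [halg.xbar_succ, halg.xhat_eq]
  module

theorem xtil_succ_mem_dom
    (halg : IsLinearizedASGARD f g h M S ydot L β₀ τ β B xhat xbar xtil ystar)
    (hs : IsStepSizes L (opNormInv S M ^ 2) β₀ τ β B) (hne : (dom g).Nonempty) (k : ℕ) :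
    xtil (k + 1) ∈ dom g :=
  (halg.xtil_succ k).mem_dom (one_div_pos.2 (mul_pos (hs.tau_pos k) (hs.B_pos k))) hne

theorem xbar_succ_mem_dom
    (halg : IsLinearizedASGARD f g h M S ydot L β₀ τ β B xhat xbar xtil ystar)
    (hs : IsStepSizes L (opNormInv S M ^ 2) β₀ τ β B) (hne : (dom g).Nonempty)
    (hgconv : Convex ℝ (dom g)) (k : ℕ) : xbar (k + 1) ∈ dom g := by
  have hxtil := halg.xtil_succ_mem_dom hs hne
  induction k with
  | zero =>
    rw [halg.xbar_succ_eq, hs.tau_zero, sub_self, zero_smul, zero_add, one_smul]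
    exact hxtil 0
  | succ k ih =>
    rw [halg.xbar_succ_eq]
    exact hgconv ih (hxtil _) (sub_nonneg.2 (hs.tau_le_one _)) (hs.tau_pos _).le
      (sub_add_cancel _ _)

theorem toReal_xbar_succ_le
    (halg : IsLinearizedASGARD f g h M S ydot L β₀ τ β B xhat xbar xtil ystar)
    (hs : IsStepSizes L (opNormInv S M ^ 2) β₀ τ β B) (hne : (dom g).Nonempty)
    (hgconv : ConvexOn ℝ (dom g) fun x => (g x).toReal) (k : ℕ) :
    (g (xbar (k + 1))).toReal ≤
      (1 - τ k) * (g (xbar k)).toReal + τ k * (g (xtil (k + 1))).toReal := by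
  rw [halg.xbar_succ_eq]
  cases k with
  | zero => simp [hs.tau_zero]
  | succ k =>
    exact hgconv.2 (halg.xbar_succ_mem_dom hs hne hgconv.1 k) (halg.xtil_succ_mem_dom hs hne _)
      (sub_nonneg.2 (hs.tau_le_one _)) (hs.tau_pos _).le (sub_add_cancel _ _)

theorem regLagrangian_step
    (halg : IsLinearizedASGARD f g h M S ydot L β₀ τ β B xhat xbar xtil ystar)
    (hs : IsStepSizes L (opNormInv S M ^ 2) β₀ τ β B) (hS : IsPositiveDefinite S)
    (hf : IsConvexWithLipschitzGradient f L) (hgbot : ∀ x, g x ≠ ⊥)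
    (hgconv : ConvexOn ℝ (dom g) fun x => (g x).toReal) (hhbot : ∀ u, h u ≠ ⊥)
    {xs : H} (hxs : xs ∈ dom g) (hMxs : M xs ∈ dom h) {y : G} (hy : y ∈ dom (conj h)) (k : ℕ) :
    regLagrangian f g h M S ydot (β (k + 1)) (xbar (k + 1)) y
        + τ k ^ 2 * B (k + 1) / 2 * ‖xtil (k + 1) - xs‖ ^ 2 ≤
      (1 - τ k) * regLagrangian f g h M S ydot (β k) (xbar k) (ystar k)
        + τ k * (f xs + (g xs).toReal + (h (M xs)).toReal)
        + τ k ^ 2 * B (k + 1) / 2 * ‖xtil k - xs‖ ^ 2 := by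
  rw [← hs.one_add_tau_mul_beta_succ k]
  exact regLagrangian_accelerated_step hf hgbot hgconv hhbot hS (hs.beta_pos _) (hs.tau_pos k)
    (hs.tau_le_one k) (hs.B_succ k) (hs.B_pos k) (halg.xhat_eq k) (halg.xbar_succ_eq k)
    (halg.ystar_argmax k) (halg.xtil_succ k) (halg.toReal_xbar_succ_le hs ⟨xs, hxs⟩ hgconv k)
    hxs hMxs hy

theorem regLagrangian_add_le
    (halg : IsLinearizedASGARD f g h M S ydot L β₀ τ β B xhat xbar xtil ystar)
    (hs : IsStepSizes L (opNormInv S M ^ 2) β₀ τ β B) (hS : IsPositiveDefinite S)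
    (hf : IsConvexWithLipschitzGradient f L) (hgbot : ∀ x, g x ≠ ⊥)
    (hgconv : ConvexOn ℝ (dom g) fun x => (g x).toReal) (hhbot : ∀ u, h u ≠ ⊥)
    {xs : H} (hxs : xs ∈ dom g) (hMxs : M xs ∈ dom h) (k : ℕ) {y : G} (hy : y ∈ dom (conj h)) :
    regLagrangian f g h M S ydot (β (k + 1)) (xbar (k + 1)) y
        + τ k ^ 2 * B (k + 1) / 2 * ‖xtil (k + 1) - xs‖ ^ 2 ≤
      f xs + (g xs).toReal + (h (M xs)).toReal
        + τ k ^ 2 * B (k + 1) / 2 * ‖xtil 0 - xs‖ ^ 2 := by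
  induction k generalizing y with
  | zero =>
    simpa [hs.tau_zero] using halg.regLagrangian_step hs hS hf hgbot hgconv hhbot hxs hMxs hy 0
  | succ k ih =>
    have hstar := (halg.ystar_argmax (k + 1)).mem_dom ⟨M xs, hMxs⟩ ⟨y, hy⟩
    have hprev := mul_le_mul_of_nonneg_left (ih hstar) (sub_nonneg.2 (hs.tau_le_one (k + 1)))
    have hrec := hs.tau_sq_mul_B_succ k
    have hnext := halg.regLagrangian_step hs hS hf hgbot hgconv hhbot hxs hMxs hy (k + 1)
    simp only [add_assoc, Nat.reduceAdd, hrec] at hnext ⊢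
    linarith

theorem regLagrangian_le
    (halg : IsLinearizedASGARD f g h M S ydot L β₀ τ β B xhat xbar xtil ystar)
    (hs : IsStepSizes L (opNormInv S M ^ 2) β₀ τ β B) (hS : IsPositiveDefinite S)
    (hf : IsConvexWithLipschitzGradient f L) (hgbot : ∀ x, g x ≠ ⊥)
    (hgconv : ConvexOn ℝ (dom g) fun x => (g x).toReal) (hhbot : ∀ u, h u ≠ ⊥)
    {xs : H} (hxs : xs ∈ dom g) (hMxs : M xs ∈ dom h) (k : ℕ) {y : G} (hy : y ∈ dom (conj h)) :
    regLagrangian f g h M S ydot (β₀ / (k + 1)) (xbar (k + 1)) y ≤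
      f xs + (g xs).toReal + (h (M xs)).toReal
        + 1 / (k + 1) * (L / 2 + opNormInv S M ^ 2 / (2 * β 1)) * ‖xtil 0 - xs‖ ^ 2 := by
  have hpotential := halg.regLagrangian_add_le hs hS hf hgbot hgconv hhbot hxs hMxs k hy
  have hB := hs.B_pos k
  have hdist : 0 ≤ τ k ^ 2 * B (k + 1) / 2 * ‖xtil (k + 1) - xs‖ ^ 2 := by positivity
  have hrate : τ k ^ 2 * B (k + 1) / 2 * ‖xtil 0 - xs‖ ^ 2 ≤
      1 / (k + 1) * (L / 2 + opNormInv S M ^ 2 / (2 * β 1)) * ‖xtil 0 - xs‖ ^ 2 :=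
    calc τ k ^ 2 * B (k + 1) / 2 * ‖xtil 0 - xs‖ ^ 2
        ≤ 1 / (k + 1) * B 1 / 2 * ‖xtil 0 - xs‖ ^ 2 := by
          gcongr ?_ / 2 * _
          exact hs.tau_sq_mul_B_le k
      _ = _ := by
          rw [hs.B_succ 0]
          ring
  linarith [regLagrangian_anti (f := f) (g := g) (h := h) (M := M) (S := S) (ydot := ydot)
    (hs.beta_succ_le k) (xbar (k + 1)) y]

end IsLinearizedASGARD

section Duality

section MinimalNorm

variable {H : Type*} [NormedAddCommGroup H] [InnerProductSpace ℝ H]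

theorem exists_mem_forall_norm_sq_le_inner {A : Set H} (hne : A.Nonempty) (hcomp : IsComplete A)
    (hconv : Convex ℝ A) : ∃ v ∈ A, ∀ w ∈ A, ‖v‖ ^ 2 ≤ ⟪v, w⟫_ℝ := by
  obtain ⟨v, hv, hmin⟩ := exists_norm_eq_iInf_of_complete_convex hne hcomp hconv 0
  refine ⟨v, hv, fun w hw => ?_⟩
  have hvar := (norm_eq_iInf_iff_real_inner_le_zero hconv hv).1 hmin w hw
  rw [zero_sub, inner_neg_left, inner_sub_right, real_inner_self_eq_norm_sq] at hvar
  linarith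

theorem cauchySeq_of_norm_sub_sq_le {E : Type*} [SeminormedAddCommGroup E] {m : ℕ → E}
    (hm : ∀ n k, n ≤ k → ‖m k - m n‖ ^ 2 ≤ ‖m k‖ ^ 2 - ‖m n‖ ^ 2) {R : ℝ} (hR : ∀ n, ‖m n‖ ≤ R) :
    CauchySeq m := by
  have hmono : Monotone fun n => ‖m n‖ ^ 2 := fun n k hnk =>
    sub_nonneg.1 ((sq_nonneg _).trans (hm n k hnk))
  have hbdd : BddAbove (Set.range fun n => ‖m n‖ ^ 2) :=
    ⟨R ^ 2, Set.forall_mem_range.2 fun n => by gcongr; exact hR n⟩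
  have hcauchy := (tendsto_atTop_ciSup hmono hbdd).cauchySeq
  refine Metric.cauchySeq_iff'.2 fun ε hε => ?_
  obtain ⟨N, hN⟩ := Metric.cauchySeq_iff'.1 hcauchy (ε ^ 2) (by positivity)
  refine ⟨N, fun n hn => ?_⟩
  rw [dist_eq_norm]
  exact lt_of_pow_lt_pow_left₀ 2 hε.le
    ((hm N n hn).trans_lt ((le_abs_self _).trans_lt (hN n hn)))

variable [CompleteSpace H]

/- The points of minimal norm of the sets form a Cauchy sequence. -/
theorem nonempty_iInter_of_antitone_convex {A : ℕ → Set H} (hanti : Antitone A)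
    (hne : ∀ n, (A n).Nonempty) (hcl : ∀ n, IsClosed (A n)) (hconv : ∀ n, Convex ℝ (A n))
    (hbdd : Bornology.IsBounded (A 0)) : (⋂ n, A n).Nonempty := by
  choose m hmA hmin using fun n =>
    exists_mem_forall_norm_sq_le_inner (hne n) (hcl n).isComplete (hconv n)
  obtain ⟨R, hR⟩ := hbdd.exists_norm_le
  have hcauchy : CauchySeq m := by
    refine cauchySeq_of_norm_sub_sq_le (fun n k hnk => ?_) fun n => hR _ (hanti n.zero_le (hmA n))
    rw [norm_sub_sq_real, real_inner_comm]
    linarith [hmin n (m k) (hanti hnk (hmA k))]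
  obtain ⟨a, ha⟩ := cauchySeq_tendsto_of_complete hcauchy
  refine ⟨a, Set.mem_iInter.2 fun n => (hcl n).mem_of_tendsto ha ?_⟩
  filter_upwards [Filter.eventually_ge_atTop n] with k hk using hanti hk (hmA k)

theorem isClosed_image_of_isBounded_convex {G : Type*} [NormedAddCommGroup G] [NormedSpace ℝ G]
    (M : H →L[ℝ] G) {A : Set H} (hcl : IsClosed A) (hconv : Convex ℝ A)
    (hbdd : Bornology.IsBounded A) : IsClosed (M '' A) := by
  refine isClosed_of_closure_subset fun w hw => ?_
  let F : ℕ → Set H := fun n => A ∩ M ⁻¹' Metric.closedBall w (1 / ((n : ℝ) + 1))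
  have hanti : Antitone F := fun n k hnk => by
    dsimp only [F]
    gcongr
  have hne : ∀ n, (F n).Nonempty := fun n => by
    obtain ⟨_, ⟨x, hxA, rfl⟩, hx⟩ := Metric.mem_closure_iff.1 hw (1 / ((n : ℝ) + 1))
      (by positivity)
    exact ⟨x, hxA, Metric.mem_closedBall'.2 hx.le⟩
  obtain ⟨x, hx⟩ := nonempty_iInter_of_antitone_convex hanti hne
    (fun n => hcl.inter (Metric.isClosed_closedBall.preimage M.continuous))
    (fun n => hconv.inter ((convex_closedBall _ _).linear_preimage (M : H →ₗ[ℝ] G)))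
    (hbdd.subset Set.inter_subset_left)
  rw [Set.mem_iInter] at hx
  exact ⟨x, (hx 0).1, dist_le_zero.1
    (ge_of_tendsto' tendsto_one_div_add_atTop_nhds_zero_nat fun n => (hx n).2)⟩

end MinimalNorm

section Multiplier

/- By Baire, one of the sets `n • (K - c)` has an interior point. -/
theorem mem_nhds_of_isClosed_convex_absorbing {E : Type*} [AddCommGroup E] [Module ℝ E]
    [TopologicalSpace E] [IsTopologicalAddGroup E] [ContinuousSMul ℝ E] [BaireSpace E]
    {K : Set E} (hcl : IsClosed K) (hconv : Convex ℝ K) {c : E}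
    (hK : ∀ w, ∃ s : ℝ, 0 < s ∧ c + s • w ∈ K) : K ∈ nhds c := by
  have hc : c ∈ K := by simpa using (hK 0).choose_spec.2
  have hscale : ∀ n : ℕ, ((n : ℝ) + 1)⁻¹ ≠ 0 := fun n => by positivity
  let e : ℕ → E ≃ₜ E := fun n => (Homeomorph.smulOfNeZero _ (hscale n)).trans (Homeomorph.addLeft c)
  have hcover : ⋃ n, e n ⁻¹' K = Set.univ := Set.eq_univ_of_forall fun w => by
    obtain ⟨s, hs, hsK⟩ := hK w
    obtain ⟨n, hn⟩ := exists_nat_one_div_lt hs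
    refine Set.mem_iUnion.2 ⟨n, ?_⟩
    have hmem := hconv.add_smul_sub_mem hc hsK (t := ((n : ℝ) + 1)⁻¹ / s)
      ⟨by positivity, (div_le_one hs).2 (by simpa using hn.le)⟩
    rwa [add_sub_cancel_left, smul_smul, div_mul_cancel₀ _ hs.ne'] at hmem
  obtain ⟨n, v, hv⟩ := nonempty_interior_of_iUnion_of_closed
    (fun n => hcl.preimage (e n).continuous) hcover
  rw [← (e n).preimage_interior] at hv
  obtain ⟨s, hs, hsK⟩ := hK (c - e n v)
  refine mem_interior_iff_mem_nhds.1
    (hconv.openSegment_interior_self_subset_interior hv hsK ?_)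
  refine ⟨s / (1 + s), 1 / (1 + s), by positivity, by positivity, by field_simp; ring, ?_⟩
  match_scalars <;> field_simp
  ring

theorem eventually_exists_mem_le_add_one {H G : Type*}
    [NormedAddCommGroup H] [InnerProductSpace ℝ H] [CompleteSpace H]
    [NormedAddCommGroup G] [NormedSpace ℝ G] [CompleteSpace G] (M : H →L[ℝ] G)
    {C : Set H} {φ : H → ℝ} (hφ : ConvexOn ℝ C φ) (hcl : ∀ r, IsClosed {x | x ∈ C ∧ φ x ≤ r})
    {x₀ : H} (hx₀ : x₀ ∈ C) (hcone : ∀ w, ∃ t : ℝ, 0 < t ∧ ∃ z ∈ C, w = t • (M z - M x₀)) :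
    ∀ᶠ w in nhds (M x₀), ∃ x ∈ C, M x = w ∧ φ x ≤ φ x₀ + 1 := by
  let A : Set H := {x | x ∈ C ∧ φ x ≤ φ x₀ + 1} ∩ Metric.closedBall x₀ 1
  have hAconv : Convex ℝ A := (hφ.convex_le _).inter (convex_closedBall _ _)
  have hclosed : IsClosed (M '' A) := isClosed_image_of_isBounded_convex M
    ((hcl _).inter Metric.isClosed_closedBall) hAconv
    (Metric.isBounded_closedBall.subset Set.inter_subset_right)
  have habsorbing : ∀ w, ∃ s : ℝ, 0 < s ∧ M x₀ + s • w ∈ M '' A := fun w => by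
    obtain ⟨t, ht, z, hz, rfl⟩ := hcone w
    set s : ℝ := 1 / (1 + |φ z - φ x₀| + ‖z - x₀‖)
    have hs : 0 < s := by positivity
    have hsum : s * (1 + |φ z - φ x₀| + ‖z - x₀‖) = 1 := one_div_mul_cancel (by positivity)
    have hs_abs : 0 ≤ s * |φ z - φ x₀| := by positivity
    have hs_norm : 0 ≤ s * ‖z - x₀‖ := by positivity
    have hs1 : s ≤ 1 := by linarith
    refine ⟨s / t, by positivity, (1 - s) • x₀ + s • z, ⟨⟨?_, ?_⟩, ?_⟩, ?_⟩
    · exact hφ.1 hx₀ hz (sub_nonneg.2 hs1) hs.le (sub_add_cancel _ _)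
    · have hconv := hφ.2 hx₀ hz (sub_nonneg.2 hs1) hs.le (sub_add_cancel _ _)
      have habs := mul_le_mul_of_nonneg_left (le_abs_self (φ z - φ x₀)) hs.le
      simp only [smul_eq_mul] at hconv
      linarith
    · rw [Metric.mem_closedBall, dist_eq_norm,
        show (1 - s) • x₀ + s • z - x₀ = s • (z - x₀) by module, norm_smul_of_nonneg hs.le]
      linarith
    · rw [smul_smul, div_mul_cancel₀ _ ht.ne', map_add, map_smul, map_smul]
      module
  filter_upwards [mem_nhds_of_isClosed_convex_absorbing hclosed
    (hAconv.linear_image (M : H →ₗ[ℝ] G)) habsorbing]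
  rintro _ ⟨x, hx, rfl⟩
  exact ⟨x, hx.1.1, rfl, hx.1.2⟩

/- Separates `(c, m)` from the strict epigraph of the value function
`w ↦ inf {φ x | x ∈ C, M x = w}`; the separating hyperplane is not vertical because the value
function is bounded above near `c`. -/
theorem exists_dual_le_add_of_eventually_le {H G : Type*} [AddCommGroup H] [Module ℝ H]
    [AddCommGroup G] [Module ℝ G] [TopologicalSpace G] [IsTopologicalAddGroup G]
    [ContinuousSMul ℝ G] (M : H →ₗ[ℝ] G) {C : Set H} {φ : H → ℝ} (hφ : ConvexOn ℝ C φ)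
    {c : G} {b m : ℝ} (hb : ∀ᶠ w in nhds c, ∃ x ∈ C, M x = w ∧ φ x ≤ b)
    (hm : ∀ x ∈ C, M x = c → m ≤ φ x) :
    ∃ l : StrongDual ℝ G, ∀ x ∈ C, m ≤ φ x + l (M x - c) := by
  let E : Set (G × ℝ) := M.prodMap LinearMap.id '' {p | p.1 ∈ C ∧ φ p.1 < p.2}
  have hE : Convex ℝ E := hφ.convex_strict_epigraph.linear_image _
  have hint : (c, b + 1) ∈ interior E := by
    rw [mem_interior_iff_mem_nhds]
    filter_upwards [prod_mem_nhds hb (Ioi_mem_nhds (lt_add_one b))]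
    rintro ⟨w, r⟩ ⟨⟨x, hx, rfl, hxb⟩, hr⟩
    exact ⟨(x, r), ⟨hx, hxb.trans_lt hr⟩, rfl⟩
  have hnotMem : (c, m) ∉ interior E := fun hmem => by
    obtain ⟨⟨x, r⟩, ⟨hx, hxr⟩, hxc⟩ := interior_subset hmem
    obtain ⟨hMx, rfl⟩ := Prod.mk_inj.1 hxc
    exact (hm x hx hMx).not_gt hxr
  obtain ⟨l, hl⟩ := geometric_hahn_banach_open_point hE.interior isOpen_interior hnotMem
  have hsplit : ∀ w r, l (w, r) = l (w, 0) + r * l (0, 1) := fun w r => by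
    rw [← smul_eq_mul, ← map_smul, ← map_add]
    simp
  have hle : ∀ p ∈ E, l p ≤ l (c, m) := fun p hp =>
    closure_minimal (fun a ha => (hl a ha).le) (isClosed_le l.continuous continuous_const)
      ((hE.closure_interior_eq_closure_of_nonempty_interior ⟨_, hint⟩).ge (subset_closure hp))
  have hneg : l (0, 1) < 0 := by
    obtain ⟨x, hx, hxc, hxb⟩ := hb.self_of_nhds
    have hstrict := hl _ hint
    rw [hsplit c, hsplit c m] at hstrict
    nlinarith [hm x hx hxc]
  refine ⟨(l (0, 1))⁻¹ • l.comp (ContinuousLinearMap.inl ℝ G ℝ), fun x hx =>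
    le_of_forall_pos_le_add fun ε hε => ?_⟩
  have hsep := hle (M x, φ x + ε) ⟨(x, φ x + ε), ⟨hx, lt_add_of_pos_right _ hε⟩, rfl⟩
  rw [hsplit, hsplit c] at hsep
  have hdiff : l (M x - c, 0) = l (M x, 0) - l (c, 0) := by
    rw [← map_sub, Prod.mk_sub_mk, sub_zero]
  have hscaled : l (0, 1) * (φ x + (l (0, 1))⁻¹ * l (M x - c, 0) + ε) ≤ l (0, 1) * m := by
    rw [mul_add, mul_add, mul_inv_cancel_left₀ hneg.ne, hdiff]
    linarith
  simpa using (mul_le_mul_left_of_neg hneg).1 hscaled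

/- The qualification condition only makes `M '' C` absorbing in the closed subspace
`M '' vectorSpan ℝ C`, so the multiplier is built for `M` followed by the projection onto it. -/
theorem exists_lagrange_multiplier {H G : Type*}
    [NormedAddCommGroup H] [InnerProductSpace ℝ H] [CompleteSpace H]
    [NormedAddCommGroup G] [InnerProductSpace ℝ G] [CompleteSpace G] (M : H →L[ℝ] G)
    {C : Set H} {φ : H → ℝ} (hφ : ConvexOn ℝ C φ) (hcl : ∀ r, IsClosed {x | x ∈ C ∧ φ x ≤ r})
    {x₀ : H} (hx₀ : x₀ ∈ relInterior C) (hM : IsClosed (M '' (vectorSpan ℝ C : Set H))) {m : ℝ}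
    (hm : ∀ x ∈ C, M x = M x₀ → m ≤ φ x) :
    ∃ y : G, ∀ x ∈ C, m ≤ φ x + ⟪M x - M x₀, y⟫_ℝ := by
  obtain ⟨hx₀C, hcone⟩ := hx₀
  let W : Submodule ℝ G := (vectorSpan ℝ C).map (M : H →ₗ[ℝ] G)
  have : CompleteSpace W := IsClosed.isComplete hM |>.completeSpace_coe
  let P : G →L[ℝ] W := W.orthogonalProjectionOnto
  have hP : ∀ x ∈ C, (P (M x - M x₀) : G) = M x - M x₀ := fun x hx =>
    congrArg Subtype.val (Submodule.orthogonalProjectionOnto_mem_subspace_eq_self (K := W)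
      ⟨M x - M x₀, x - x₀, vsub_mem_vectorSpan ℝ hx hx₀C, map_sub M x x₀⟩)
  have habsorbing : ∀ w, ∃ t : ℝ, 0 < t ∧ ∃ z ∈ C, w = t • ((P ∘L M) z - (P ∘L M) x₀) := by
    rintro ⟨_, v, hv, rfl⟩
    obtain ⟨t, ht, z, hz, rfl⟩ := hcone v hv
    refine ⟨t, ht, z, hz, Subtype.ext ?_⟩
    rw [ContinuousLinearMap.comp_apply, ContinuousLinearMap.comp_apply, ← map_sub,
      Submodule.coe_smul, hP z hz]
    simp
  obtain ⟨l, hl⟩ := exists_dual_le_add_of_eventually_le (P ∘L M : H →ₗ[ℝ] W) hφ (m := m)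
    (eventually_exists_mem_le_add_one (P ∘L M) hφ hcl hx₀C habsorbing) fun x hx hPx => by
      refine hm x hx (sub_eq_zero.1 ?_)
      rw [← hP x hx, map_sub, sub_eq_zero.2 (show P (M x) = P (M x₀) from hPx), Submodule.coe_zero]
  refine ⟨(InnerProductSpace.toDual ℝ G).symm (l ∘L P), fun x hx => ?_⟩
  rw [real_inner_comm, InnerProductSpace.toDual_symm_apply, ContinuousLinearMap.comp_apply, map_sub]
  exact hl x hx

end Multiplier

end Duality

section Objectives

variable {H G : Type*}
  [NormedAddCommGroup H] [InnerProductSpace ℝ H]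
  [NormedAddCommGroup G] [InnerProductSpace ℝ G]
  {f : H → ℝ} {g : H → EReal} {h : G → EReal} {M : H →L[ℝ] G} {c : G}

section Primal

variable {x z : H}

theorem coe_add_sub_coe_add_eq {X : Type*} {f : X → ℝ} {g : X → EReal} {x z : X}
    (hgbot : ∀ x, g x ≠ ⊥) (hx : x ∈ dom g) (hz : z ∈ dom g) :
    ((f x : EReal) + g x) - ((f z : EReal) + g z) =
      ((f x + (g x).toReal - (f z + (g z).toReal) : ℝ) : EReal) := by
  rw [EReal.coe_sub, EReal.coe_add, EReal.coe_add, coe_toReal_of_mem_dom hgbot hx,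
    coe_toReal_of_mem_dom hgbot hz]

theorem primalObj_eq_coe (hgbot : ∀ x, g x ≠ ⊥) (hhbot : ∀ u, h u ≠ ⊥) (hx : x ∈ dom g)
    (hMx : M x ∈ dom h) :
    primalObj f g h M x = ((f x + (g x).toReal + (h (M x)).toReal : ℝ) : EReal) := by
  rw [primalObj, EReal.coe_add, EReal.coe_add, coe_toReal_of_mem_dom hgbot hx,
    coe_toReal_of_mem_dom hhbot hMx]

theorem primalObj_lt_top_iff (hgbot : ∀ x, g x ≠ ⊥) (hhbot : ∀ u, h u ≠ ⊥) :
    primalObj f g h M x < ⊤ ↔ x ∈ dom g ∧ M x ∈ dom h := by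
  refine ⟨fun hlt => ⟨?_, ?_⟩, fun ⟨hx, hMx⟩ => ?_⟩
  · by_contra hx
    rw [primalObj, eq_top_of_notMem_dom hx, EReal.coe_add_top,
      EReal.top_add_of_ne_bot (hhbot _)] at hlt
    exact hlt.ne rfl
  · by_contra hMx
    rw [primalObj, eq_top_of_notMem_dom hMx, EReal.add_top_of_ne_bot] at hlt
    · exact hlt.ne rfl
    · simp [EReal.add_eq_bot_iff, hgbot x]
  · rw [primalObj_eq_coe hgbot hhbot hx hMx]
    exact EReal.coe_lt_top _

theorem mem_dom_of_mem_primalSolutions (hgbot : ∀ x, g x ≠ ⊥) (hhbot : ∀ u, h u ≠ ⊥)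
    (hdom : ∃ x, x ∈ dom g ∧ M x ∈ dom h) (hz : z ∈ primalSolutions f g h M) :
    z ∈ dom g ∧ M z ∈ dom h := by
  obtain ⟨x, hx⟩ := hdom
  exact (primalObj_lt_top_iff hgbot hhbot).1
    ((hz x).trans_lt ((primalObj_lt_top_iff hgbot hhbot).2 hx))

end Primal

section EqualityConstraint

theorem mem_dom_indicatorPoint {G : Type*} {c u : G} : u ∈ dom (indicatorPoint c) ↔ u = c := by
  by_cases hu : u = c <;> simp [dom, indicatorPoint, hu]

theorem indicatorPoint_ne_bot {G : Type*} (c u : G) : indicatorPoint c u ≠ ⊥ := by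
  by_cases hu : u = c <;> simp [indicatorPoint, hu]

theorem conj_indicatorPoint (c y : G) : conj (indicatorPoint c) y = ((⟪c, y⟫_ℝ : ℝ) : EReal) := by
  refine le_antisymm (iSup_le fun u => ?_) (le_iSup_of_le c (by simp [indicatorPoint]))
  by_cases hu : u = c <;> simp [indicatorPoint, hu]

theorem mem_dom_conj_indicatorPoint (c y : G) : y ∈ dom (conj (indicatorPoint c)) := by
  rw [dom, Set.mem_ofPred_eq, conj_indicatorPoint]
  exact EReal.coe_lt_top _

theorem regLagrangian_indicatorPoint (S : G →L[ℝ] G) (ydot : G) (b : ℝ) (x : H) (y : G) :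
    regLagrangian f g (indicatorPoint c) M S ydot b x y =
      f x + (g x).toReal + ⟪M x - c, y⟫_ℝ - b / 2 * normOp S (y - ydot) ^ 2 := by
  rw [regLagrangian, conj_indicatorPoint, EReal.toReal_coe, inner_sub_left]
  ring

theorem lagrangian_indicatorPoint (hgbot : ∀ x, g x ≠ ⊥) {x : H} (hx : x ∈ dom g) (y : G) :
    lagrangian f g (indicatorPoint c) M x y =
      ((f x + (g x).toReal + ⟪M x - c, y⟫_ℝ : ℝ) : EReal) := by
  rw [lagrangian, conj_indicatorPoint, inner_sub_left, ← add_sub_assoc, EReal.coe_sub,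
    EReal.coe_add, EReal.coe_add, coe_toReal_of_mem_dom hgbot hx]

theorem coe_le_dualObj_indicatorPoint_iff (hgbot : ∀ x, g x ≠ ⊥) {r : ℝ} {y : G} :
    (r : EReal) ≤ dualObj f g (indicatorPoint c) M y ↔
      ∀ x ∈ dom g, r ≤ f x + (g x).toReal + ⟪M x - c, y⟫_ℝ := by
  rw [dualObj, le_iInf_iff]
  refine forall_congr' fun x => ?_
  by_cases hx : x ∈ dom g
  · rw [lagrangian_indicatorPoint hgbot hx, EReal.coe_le_coe_iff, forall_prop_of_true hx]
  · simp [hx, lagrangian, conj_indicatorPoint, eq_top_of_notMem_dom hx]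

theorem IsSaddlePoint.coe_le_dualObj (hgbot : ∀ x, g x ≠ ⊥) {x : H} {y : G}
    (hsaddle : IsSaddlePoint f g (indicatorPoint c) M x y) (hx : x ∈ dom g) (hMx : M x = c) :
    ((f x + (g x).toReal : ℝ) : EReal) ≤ dualObj f g (indicatorPoint c) M y := by
  refine le_iInf fun z => le_of_eq_of_le ?_ (hsaddle z y).2
  rw [lagrangian_indicatorPoint hgbot hx, hMx, sub_self, inner_zero_left, add_zero]

theorem coe_le_dualObj_of_mem_dualSolutions [CompleteSpace H] [CompleteSpace G]
    (hf : ConvexOn ℝ Set.univ f) (hcont : Continuous f) (hg : IsProperLscConvex g)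
    (hri : ∃ x, x ∈ relInterior (dom g) ∧ M x = c)
    (hM : IsClosed (M '' (vectorSpan ℝ (dom g) : Set H))) {m : ℝ}
    (hm : ∀ x ∈ dom g, M x = c → m ≤ f x + (g x).toReal) {y : G}
    (hy : y ∈ dualSolutions f g (indicatorPoint c) M) :
    (m : EReal) ≤ dualObj f g (indicatorPoint c) M y := by
  obtain ⟨x₀, hx₀, rfl⟩ := hri
  have hgconv := convexOn_toReal hg.ne_bot hg.convex
  obtain ⟨z, hz⟩ := exists_lagrange_multiplier M
    ((hf.subset (Set.subset_univ _) hgconv.1).add hgconv)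
    (isClosed_sublevel_add hg.ne_bot hg.lsc hcont) hx₀ hM hm
  exact ((coe_le_dualObj_indicatorPoint_iff hg.ne_bot).2 hz).trans (hy z)

theorem le_lagrangian_of_mem_solutions [CompleteSpace H] [CompleteSpace G]
    (hf : ConvexOn ℝ Set.univ f) (hcont : Continuous f) (hg : IsProperLscConvex g)
    (hri : ∃ x, x ∈ relInterior (dom g) ∧ M x = c)
    {xs : H} (hxs : xs ∈ primalSolutions f g (indicatorPoint c) M) (hxsg : xs ∈ dom g)
    (hMxs : M xs = c) {ys : G} (hys : ys ∈ dualSolutions f g (indicatorPoint c) M)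
    (hq : IsClosed (M '' (vectorSpan ℝ (dom g) : Set H)) ∨
      IsSaddlePoint f g (indicatorPoint c) M xs ys) {x : H} (hx : x ∈ dom g) :
    f xs + (g xs).toReal ≤ f x + (g x).toReal + ⟪M x - c, ys⟫_ℝ := by
  refine (coe_le_dualObj_indicatorPoint_iff hg.ne_bot).1 ?_ x hx
  rcases hq with hM | hsaddle
  · refine coe_le_dualObj_of_mem_dualSolutions hf hcont hg hri hM (fun z hz hMz => ?_) hys
    have hle := hxs z
    rw [primalObj_eq_coe hg.ne_bot (indicatorPoint_ne_bot c) hxsg (mem_dom_indicatorPoint.2 hMxs),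
      primalObj_eq_coe hg.ne_bot (indicatorPoint_ne_bot c) hz (mem_dom_indicatorPoint.2 hMz),
      EReal.coe_le_coe_iff, hMxs, hMz] at hle
    exact le_of_add_le_add_right hle
  · exact hsaddle.coe_le_dualObj hg.ne_bot hxsg hMxs

end EqualityConstraint

end Objectives

section EqualityConstraintRates

theorem le_mul_add_sqrt {r a b C : ℝ} (hb : 0 < b) (h : 1 / (2 * b) * r ^ 2 - a * r ≤ C) :
    r ≤ b * (a + √(a ^ 2 + 2 / b * C)) := by
  rw [← div_le_iff₀' hb, ← sub_le_iff_le_add']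
  refine Real.le_sqrt_of_sq_le ?_
  calc (r / b - a) ^ 2 = a ^ 2 + 2 / b * (1 / (2 * b) * r ^ 2 - a * r) := by field_simp; ring
    _ ≤ a ^ 2 + 2 / b * C := by gcongr

variable {G : Type*} [NormedAddCommGroup G] [InnerProductSpace ℝ G] [CompleteSpace G]
  {S : G →L[ℝ] G} {r ydot ys : G} {b C : ℝ}

theorem IsPositiveDefinite.inner_add_normOp_inverse_sq_le (hS : IsPositiveDefinite S) (hb : 0 < b)
    (hle : ∀ y, ⟪r, y⟫_ℝ - b / 2 * normOp S (y - ydot) ^ 2 ≤ C) :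
    ⟪r, ydot⟫_ℝ + 1 / (2 * b) * normOp S.inverse r ^ 2 ≤ C := by
  convert hle (ydot + b⁻¹ • S.inverse r) using 1
  rw [inner_add_right, real_inner_smul_right, hS.inner_inverse_self, add_sub_cancel_left,
    hS.normOp_smul_sq, hS.normOp_apply_inverse]
  field_simp
  ring

theorem IsPositiveDefinite.normOp_inverse_le_of_forall_le (hS : IsPositiveDefinite S) (hb : 0 < b)
    (hle : ∀ y, ⟪r, y⟫_ℝ - b / 2 * normOp S (y - ydot) ^ 2 ≤ ⟪r, ys⟫_ℝ + C) :
    normOp S.inverse r ≤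
      b * (normOp S (ys - ydot) + √(normOp S (ys - ydot) ^ 2 + 2 / b * C)) := by
  refine le_mul_add_sqrt hb ?_
  have hmax := hS.inner_add_normOp_inverse_sq_le hb hle
  have hcs := (le_abs_self _).trans (hS.abs_inner_le r (ys - ydot))
  rw [inner_sub_right] at hcs
  linarith

variable {H : Type*} [NormedAddCommGroup H] [InnerProductSpace ℝ H] [CompleteSpace H]
  {f : H → ℝ} {g : H → EReal} {M : H →L[ℝ] G} {c : G} {L β₀ : ℝ} {τ β B : ℕ → ℝ}
  {xhat xbar xtil : ℕ → H} {ystar : ℕ → G}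

namespace IsLinearizedASGARD

theorem add_inner_sub_le_of_indicatorPoint
    (halg : IsLinearizedASGARD f g (indicatorPoint c) M S ydot L β₀ τ β B xhat xbar xtil ystar)
    (hs : IsStepSizes L (opNormInv S M ^ 2) β₀ τ β B) (hS : IsPositiveDefinite S)
    (hf : IsConvexWithLipschitzGradient f L) (hgbot : ∀ x, g x ≠ ⊥)
    (hgconv : ConvexOn ℝ (dom g) fun x => (g x).toReal) {xs : H} (hxs : xs ∈ dom g)
    (hMxs : M xs = c) (k : ℕ) (y : G) :
    f (xbar (k + 1)) + (g (xbar (k + 1))).toReal + ⟪M (xbar (k + 1)) - c, y⟫_ℝ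
        - β₀ / (k + 1) / 2 * normOp S (y - ydot) ^ 2 ≤
      f xs + (g xs).toReal
        + 1 / (k + 1) * (L / 2 + opNormInv S M ^ 2 / (2 * β 1)) * ‖xtil 0 - xs‖ ^ 2 := by
  have hle := halg.regLagrangian_le hs hS hf hgbot hgconv (indicatorPoint_ne_bot c) hxs
    (mem_dom_indicatorPoint.2 hMxs) k (mem_dom_conj_indicatorPoint c y)
  rwa [regLagrangian_indicatorPoint, hMxs, indicatorPoint, if_pos rfl, EReal.toReal_zero,
    add_zero] at hle

theorem sub_le_of_indicatorPoint
    (halg : IsLinearizedASGARD f g (indicatorPoint c) M S ydot L β₀ τ β B xhat xbar xtil ystar)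
    (hs : IsStepSizes L (opNormInv S M ^ 2) β₀ τ β B) (hS : IsPositiveDefinite S)
    (hf : IsConvexWithLipschitzGradient f L) (hgbot : ∀ x, g x ≠ ⊥)
    (hgconv : ConvexOn ℝ (dom g) fun x => (g x).toReal) {xs : H} (hxs : xs ∈ dom g)
    (hMxs : M xs = c) (k : ℕ) (y : G) :
    f (xbar (k + 1)) + (g (xbar (k + 1))).toReal - (f xs + (g xs).toReal) ≤
      1 / (k + 1) * (L / 2 + opNormInv S M ^ 2 / (2 * β 1)) * ‖xtil 0 - xs‖ ^ 2
        + normOp S y * normOp S.inverse (M (xbar (k + 1)) - c)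
        + β₀ / (2 * (k + 1)) * normOp S (y - ydot) ^ 2 := by
  have hle := halg.add_inner_sub_le_of_indicatorPoint hs hS hf hgbot hgconv hxs hMxs k y
  rw [div_div, mul_comm ((k : ℝ) + 1) 2] at hle
  linarith [neg_le_of_abs_le (hS.abs_inner_le (M (xbar (k + 1)) - c) y)]

theorem normOp_inverse_sub_le
    (halg : IsLinearizedASGARD f g (indicatorPoint c) M S ydot L β₀ τ β B xhat xbar xtil ystar)
    (hs : IsStepSizes L (opNormInv S M ^ 2) β₀ τ β B) (hS : IsPositiveDefinite S)
    (hf : IsConvexWithLipschitzGradient f L) (hgbot : ∀ x, g x ≠ ⊥)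
    (hgconv : ConvexOn ℝ (dom g) fun x => (g x).toReal) {xs : H} (hxs : xs ∈ dom g)
    (hMxs : M xs = c) (k : ℕ)
    (hlag : f xs + (g xs).toReal ≤
      f (xbar (k + 1)) + (g (xbar (k + 1))).toReal + ⟪M (xbar (k + 1)) - c, ys⟫_ℝ) :
    normOp S.inverse (M (xbar (k + 1)) - c) ≤
      β₀ / (k + 1) * (normOp S (ys - ydot) + √(normOp S (ys - ydot) ^ 2
        + 2 / β₀ * (L / 2 + opNormInv S M ^ 2 / (2 * β 1)) * ‖xtil 0 - xs‖ ^ 2)) := by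
  have hb : 0 < β₀ / ((k : ℝ) + 1) := div_pos hs.initial_pos k.cast_add_one_pos
  have hrate := hS.normOp_inverse_le_of_forall_le hb (r := M (xbar (k + 1)) - c) (ydot := ydot)
    (ys := ys) (C := 1 / (k + 1) * (L / 2 + opNormInv S M ^ 2 / (2 * β 1)) * ‖xtil 0 - xs‖ ^ 2)
    fun y => by
      linarith [halg.add_inner_sub_le_of_indicatorPoint hs hS hf hgbot hgconv hxs hMxs k y]
  convert hrate using 5
  field_simp

end IsLinearizedASGARD

end EqualityConstraintRates

section LipschitzRate

section Subgradient

variable {G : Type*} [NormedAddCommGroup G] [InnerProductSpace ℝ G]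

theorem continuous_normOp (T : G →L[ℝ] G) : Continuous (normOp T) :=
  Real.continuous_sqrt.comp (continuous_id.inner T.continuous)

theorem exists_subgradient_of_eventually_le [CompleteSpace G] {C : Set G} {φ : G → ℝ} {u : G}
    {b : ℝ} (hφ : ConvexOn ℝ C φ) (hb : ∀ᶠ w in nhds u, w ∈ C ∧ φ w ≤ b) :
    ∃ y, ∀ v ∈ C, φ u + ⟪v - u, y⟫_ℝ ≤ φ v := by
  obtain ⟨l, hl⟩ := exists_dual_le_add_of_eventually_le LinearMap.id hφ (m := φ u)
    (hb.mono fun w hw => ⟨w, hw.1, rfl, hw.2⟩) fun x _ hx => (congrArg φ hx).ge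
  refine ⟨-(InnerProductSpace.toDual ℝ G).symm l, fun v hv => ?_⟩
  have hle := hl v hv
  rw [inner_neg_right, real_inner_comm, InnerProductSpace.toDual_symm_apply]
  simp only [LinearMap.id_apply] at hle
  linarith

variable {S : G →L[ℝ] G} {h : G → EReal} {D : ℝ} {u : G}

theorem normOp_sq_le_of_subgradient [CompleteSpace G] (hS : IsPositiveDefinite S) {φ : G → ℝ}
    {y : G} (hlip : ∀ v, φ v ≤ φ u + D * normOp S.inverse (v - u))
    (hy : ∀ v, φ u + ⟪v - u, y⟫_ℝ ≤ φ v) : normOp S y ^ 2 ≤ D ^ 2 := by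
  have hdir := (hy (u + S y)).trans (hlip (u + S y))
  rw [add_sub_cancel_left, hS.normOp_inverse_apply, real_inner_comm, ← hS.normOp_sq] at hdir
  nlinarith [sq_nonneg (normOp S y - D)]

theorem mem_dom_of_lipschitz (hne : (dom h).Nonempty)
    (hlip : ∀ u v, h u ≤ h v + ((D * normOp S.inverse (u - v) : ℝ) : EReal)) (u : G) :
    u ∈ dom h := by
  obtain ⟨v, hv⟩ := hne
  exact (hlip u v).trans_lt (EReal.add_lt_top (ne_of_lt hv) (EReal.coe_ne_top _))

theorem toReal_le_add_of_lipschitz (hbot : ∀ u, h u ≠ ⊥) (hne : (dom h).Nonempty)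
    (hlip : ∀ u v, h u ≤ h v + ((D * normOp S.inverse (u - v) : ℝ) : EReal)) (u v : G) :
    (h u).toReal ≤ (h v).toReal + D * normOp S.inverse (u - v) := by
  rw [← EReal.coe_le_coe_iff, EReal.coe_add,
    coe_toReal_of_mem_dom hbot (mem_dom_of_lipschitz hne hlip u),
    coe_toReal_of_mem_dom hbot (mem_dom_of_lipschitz hne hlip v)]
  exact hlip u v

theorem toReal_le_inner_sub_conj_of_subgradient (hbot : ∀ u, h u ≠ ⊥) (hne : (dom h).Nonempty)
    {y : G} (hy : ∀ v ∈ dom h, (h u).toReal + ⟪v - u, y⟫_ℝ ≤ (h v).toReal) :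
    y ∈ dom (conj h) ∧ (h u).toReal ≤ ⟪u, y⟫_ℝ - (conj h y).toReal := by
  have hle : conj h y ≤ ((⟪u, y⟫_ℝ - (h u).toReal : ℝ) : EReal) :=
    (conj_le_coe_iff hbot).2 fun v hv => by
      have := hy v hv
      rw [inner_sub_left] at this
      linarith
  exact ((le_coe_iff (conj_ne_bot hne)).1 hle).imp_right le_sub_comm.1

theorem exists_toReal_le_inner_sub_conj_of_lipschitz [CompleteSpace G] (hbot : ∀ u, h u ≠ ⊥)
    (hne : (dom h).Nonempty) (hconv : ConvexOn ℝ (dom h) fun u => (h u).toReal)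
    (hS : IsPositiveDefinite S)
    (hlip : ∀ u v, h u ≤ h v + ((D * normOp S.inverse (u - v) : ℝ) : EReal)) (u : G) :
    ∃ y ∈ dom (conj h), (h u).toReal ≤ ⟪u, y⟫_ℝ - (conj h y).toReal ∧ normOp S y ^ 2 ≤ D ^ 2 := by
  have hdom := mem_dom_of_lipschitz hne hlip
  have hlip' := toReal_le_add_of_lipschitz hbot hne hlip
  have hcont : Continuous fun w => D * normOp S.inverse (w - u) :=
    continuous_const.mul ((continuous_normOp _).comp (continuous_sub_right u))
  have hb : ∀ᶠ w in nhds u, w ∈ dom h ∧ (h w).toReal ≤ (h u).toReal + 1 := by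
    have hlt : D * normOp S.inverse (u - u) < 1 := by simp [normOp]
    filter_upwards [hcont.tendsto u |>.eventually_lt_const hlt] with w hw
    exact ⟨hdom w, (hlip' w u).trans (by gcongr)⟩
  obtain ⟨y, hy⟩ := exists_subgradient_of_eventually_le hconv hb
  obtain ⟨hydom, hle⟩ := toReal_le_inner_sub_conj_of_subgradient hbot hne hy
  exact ⟨y, hydom, hle, normOp_sq_le_of_subgradient hS (hlip' · u) fun v => hy v (hdom v)⟩

end Subgradient

variable {H G : Type*}
  [NormedAddCommGroup H] [InnerProductSpace ℝ H] [CompleteSpace H]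
  [NormedAddCommGroup G] [InnerProductSpace ℝ G] [CompleteSpace G]
  {f : H → ℝ} {g : H → EReal} {h : G → EReal} {M : H →L[ℝ] G} {S : G →L[ℝ] G} {ydot : G}
  {L β₀ D : ℝ} {τ β B : ℕ → ℝ} {xhat xbar xtil : ℕ → H} {ystar : ℕ → G}

theorem IsLinearizedASGARD.sub_le_of_lipschitz
    (halg : IsLinearizedASGARD f g h M S ydot L β₀ τ β B xhat xbar xtil ystar)
    (hs : IsStepSizes L (opNormInv S M ^ 2) β₀ τ β B) (hS : IsPositiveDefinite S)
    (hf : IsConvexWithLipschitzGradient f L) (hgbot : ∀ x, g x ≠ ⊥)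
    (hgconv : ConvexOn ℝ (dom g) fun x => (g x).toReal) (hhbot : ∀ u, h u ≠ ⊥)
    (hhconv : ConvexOn ℝ (dom h) fun u => (h u).toReal)
    (hlip : ∀ u v, h u ≤ h v + ((D * normOp S.inverse (u - v) : ℝ) : EReal))
    {xs : H} (hxs : xs ∈ dom g) (hMxs : M xs ∈ dom h) (k : ℕ) :
    f (xbar (k + 1)) + (g (xbar (k + 1))).toReal + (h (M (xbar (k + 1)))).toReal
        - (f xs + (g xs).toReal + (h (M xs)).toReal) ≤
      1 / (k + 1) * (L / 2 + opNormInv S M ^ 2 / (2 * β 1)) * ‖xtil 0 - xs‖ ^ 2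
        + β₀ / (k + 1) * (D ^ 2 + normOp S ydot ^ 2) := by
  obtain ⟨y, hy, hattained, hyD⟩ := exists_toReal_le_inner_sub_conj_of_lipschitz hhbot
    ⟨_, hMxs⟩ hhconv hS hlip (M (xbar (k + 1)))
  have hgap := halg.regLagrangian_le hs hS hf hgbot hgconv hhbot hxs hMxs k hy
  have hb : 0 < β₀ / ((k : ℝ) + 1) := div_pos hs.initial_pos k.cast_add_one_pos
  have hdist : β₀ / (k + 1) / 2 * normOp S (y - ydot) ^ 2 ≤
      β₀ / (k + 1) * (D ^ 2 + normOp S ydot ^ 2) :=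
    calc β₀ / (k + 1) / 2 * normOp S (y - ydot) ^ 2
        ≤ β₀ / (k + 1) / 2 * (2 * (normOp S y ^ 2 + normOp S ydot ^ 2)) := by
          gcongr
          exact hS.normOp_sub_sq_le y ydot
      _ = β₀ / (k + 1) * (normOp S y ^ 2 + normOp S ydot ^ 2) := by ring
      _ ≤ β₀ / (k + 1) * (D ^ 2 + normOp S ydot ^ 2) := by gcongr
  rw [regLagrangian] at hgap
  linarith

end LipschitzRate

end SmoothASGARD

theorem theorem1 {H G : Type*}
    [NormedAddCommGroup H] [InnerProductSpace ℝ H] [CompleteSpace H]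
    [NormedAddCommGroup G] [InnerProductSpace ℝ G] [CompleteSpace G]
    (f : H → ℝ) (g : H → EReal) (h : G → EReal) (M : H →L[ℝ] G) (L : ℝ)
    (hL : 0 ≤ L) (hLM : 0 < L ∨ M ≠ 0)
    (hf : SmoothASGARD.IsConvexWithLipschitzGradient f L)
    (hg : SmoothASGARD.IsProperLscConvex g)
    (hh : SmoothASGARD.IsProperLscConvex h)
    (hdom : ∃ x, x ∈ SmoothASGARD.dom g ∧ M x ∈ SmoothASGARD.dom h)
    (S : G →L[ℝ] G) (hS : SmoothASGARD.IsPositiveDefinite S) (ydot : G)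
    (β₀ : ℝ) (hβ₀ : 0 < β₀) (τ β B : ℕ → ℝ) (xhat xbar xtil : ℕ → H) (ystar : ℕ → G)
    (halg : SmoothASGARD.IsLinearizedASGARD f g h M S ydot L β₀ τ β B xhat xbar xtil ystar) :
    -- equality constraints
    (∀ c : G, h = SmoothASGARD.indicatorPoint c →
      (∃ x, x ∈ SmoothASGARD.relInterior (SmoothASGARD.dom g) ∧ M x = c) →
      ∀ xs ∈ SmoothASGARD.primalSolutions f g h M, ∀ ys ∈ SmoothASGARD.dualSolutions f g h M,
      (IsClosed (M '' (vectorSpan ℝ (SmoothASGARD.dom g) : Set H)) ∨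
        SmoothASGARD.IsSaddlePoint f g h M xs ys) →
      ∀ k : ℕ,
        (((-(SmoothASGARD.normOp S ys * SmoothASGARD.normOp S.inverse (M (xbar (k + 1)) - c)) : ℝ) :
            EReal) ≤ ((f (xbar (k + 1)) : EReal) + g (xbar (k + 1))) - ((f xs : EReal) + g xs)) ∧
        (((f (xbar (k + 1)) : EReal) + g (xbar (k + 1))) - ((f xs : EReal) + g xs) ≤
          ((1 / ((k : ℝ) + 1) * (L / 2 + SmoothASGARD.opNormInv S M ^ 2 / (2 * β 1))
                * ‖xtil 0 - xs‖ ^ 2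
              + SmoothASGARD.normOp S ys * SmoothASGARD.normOp S.inverse (M (xbar (k + 1)) - c)
              + β₀ / (2 * ((k : ℝ) + 1)) * SmoothASGARD.normOp S (ys - ydot) ^ 2 : ℝ) : EReal)) ∧
        SmoothASGARD.normOp S.inverse (M (xbar (k + 1)) - c) ≤
          β₀ / ((k : ℝ) + 1) * (SmoothASGARD.normOp S (ys - ydot)
            + √(SmoothASGARD.normOp S (ys - ydot) ^ 2
                + 2 / β₀ * (L / 2 + SmoothASGARD.opNormInv S M ^ 2 / (2 * β 1))
                  * ‖xtil 0 - xs‖ ^ 2))) ∧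
    -- Lipschitz continuous `h`
    (∀ D : ℝ, (∀ u v : G, h u ≤ h v + ((D * SmoothASGARD.normOp S.inverse (u - v) : ℝ) : EReal)) →
      ∀ xs ∈ SmoothASGARD.primalSolutions f g h M, ∀ k : ℕ,
        SmoothASGARD.primalObj f g h M (xbar (k + 1))
            - (⨅ x, SmoothASGARD.primalObj f g h M x) ≤
          ((1 / ((k : ℝ) + 1) * (L / 2 + SmoothASGARD.opNormInv S M ^ 2 / (2 * β 1))
                * ‖xtil 0 - xs‖ ^ 2
              + β₀ / ((k : ℝ) + 1) * (D ^ 2 + SmoothASGARD.normOp S ydot ^ 2) : ℝ) : EReal)) := by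
  open SmoothASGARD in
  have hs := halg.isStepSizes hS hL hLM hβ₀
  have hgconv := convexOn_toReal hg.ne_bot hg.convex
  refine ⟨fun c hc hri xs hxs ys hys hq k => ?_, fun D hlip xs hxs k => ?_⟩
  all_goals
    obtain ⟨hxsg, hMxs⟩ := mem_dom_of_mem_primalSolutions hg.ne_bot hh.ne_bot hdom hxs
    have hxbar := halg.xbar_succ_mem_dom hs ⟨xs, hxsg⟩ hgconv.1 k
  · subst hc
    rw [mem_dom_indicatorPoint] at hMxs
    have hlag := le_lagrangian_of_mem_solutions hf.convex hf.differentiable.continuous hg hri hxs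
      hxsg hMxs hys hq hxbar
    rw [coe_add_sub_coe_add_eq hg.ne_bot hxbar hxsg, EReal.coe_le_coe_iff, EReal.coe_le_coe_iff]
    refine ⟨?_, halg.sub_le_of_indicatorPoint hs hS hf hg.ne_bot hgconv hxsg hMxs k ys,
      halg.normOp_inverse_sub_le hs hS hf hg.ne_bot hgconv hxsg hMxs k hlag⟩
    linarith [le_of_abs_le (hS.abs_inner_le (M (xbar (k + 1)) - c) ys)]
  · have hMxbar := mem_dom_of_lipschitz ⟨_, hMxs⟩ hlip (M (xbar (k + 1)))
    have hinf : ⨅ x, primalObj f g h M x = primalObj f g h M xs :=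
      le_antisymm (iInf_le _ xs) (le_iInf hxs)
    rw [hinf, primalObj_eq_coe hg.ne_bot hh.ne_bot hxbar hMxbar,
      primalObj_eq_coe hg.ne_bot hh.ne_bot hxsg hMxs, ← EReal.coe_sub, EReal.coe_le_coe_iff]
    exact halg.sub_le_of_lipschitz hs hS hf hg.ne_bot hgconv hh.ne_bot
      (convexOn_toReal hh.ne_bot hh.convex) hlip hxsg hMxs k
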